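/- Let $n\in\mathbb N$ and $\mathbf x=(x_1,\dots,x_n)\in\mathbb N^n$, where $\mathbb N=\{0,1,2,\dots\}$. **Parking functions.** $\mathrm{PF}(\mathbf x)$ is the set of $\alpha\in\mathbb N^n$ whose weakly increasing rearrangement $\alpha_{i_1}\le\dots\le\alpha_{i_n}$ satisfies $\alpha_{i_j}\le(\sum_{k=1}^j x_k)-1$ for all $1\le j\le n$; and $\mathrm{rsum}(\alpha):=\sum_{i=1}^n(n+1-i)x_i-n-\sum_{i=1}^n\alpha_i$. **Graph.** $G_{\mathbf x}$ is the loopless multigraph on $\{0,1,\dots,n\}$ with root $0$ and $\omega_{G_{\mathbf x}}(\{i,j\})=x_{\min(i,j)+1}$ copies of the edge $\{i,j\}$ for $i\neq j$. **Trees.** For a tree $T$ on $\{0,\dots,n\}$ rooted at $0$, write $i\le_T j$ if the path from $j$ to $0$ passes through $i$, and let $\mathrm{par}_T(j)$ be the parent of $j\ne 0$. $\mathrm{RPT}(n+1)$ is the set of such trees for which (a) $i\le_T j$ implies $i\le j$ for all $1\le i,j\le n$, and (b) $i\le_T k$ implies $i\le_T j$ for all $1\le i<j<k\le n$. $\mathrm{AVO}(T)$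 is the set of total orders $\prec$ on $\{1,\dots,n\}$ such that $j\prec i$ whenever $i<j$ and $\mathrm{par}_T(i)=\mathrm{par}_T(j)$. Put $$\kappa(G_{\mathbf x},T,\prec):=\sum_{\substack{1\le i,j\le n\\ i\le_T j,\ j\prec i}}\omega_{G_{\mathbf x}}(\{\mathrm{par}_T(i),j\}).$$ **Vector DFS-burning algorithm** (input $\alpha\in\mathbb N^n$). Start with a multigraph $G$ on $\{0,\dots,n\}$ whose edges are $x_1$ copies of $\{0,k\}$ for each $k\ge 1$; only $0$ burns, no edge is burnt, $c=0$, $\sigma(0)=0$, $T$ is the single vertex $0$, and the head is $h=0$. Repeat the following scan: run through the non-burning vertices $j$ from the largest to the smallest, and for each of them through the unburnt copies $e$ of $\{h,j\}$ in $G$. If $\alpha_j\ge1$, burn $e$ and decrease $\alpha_j$ by $1$. If $\alpha_j=0$, then $j$ starts to burn: increase $c$ by $1$, set $\sigma(c)=j$, add to $G$ $x_{c+1}$ copies of $\{j,k\}$ for every non-burning $k$, add $j$ and the edge $\{h,j\}$ to $T$, let $\ell(\{h,j\})$ be the number of unburnt copies of $\{h,j\}$ other than $e$, set $h=j$, and start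 a new scan. When a scan is completed: if $h\neq0$, replace $h$ by $\mathrm{par}_T(h)$ and start a new scan; if $h=0$, stop. Finally relabel the vertices of $T$ (and accordingly the edges, with their labels $\ell$) by $i\mapsto\sigma^{-1}(i)$, and let $i\prec j$ if and only if $\sigma(i)<\sigma(j)$. The output is $(T,\ell,\prec)$. **Vector DFS-burning inverse algorithm** (input $T\in\mathrm{RPT}(n+1)$, $\ell\colon E(T)\to\mathbb N$, $\prec\in\mathrm{AVO}(T)$). Start with only $0$ burning, no edge of $G_{\mathbf x}$ burnt, $\beta=(0,\dots,0)$ and head $h=0$. Repeat the following scan: run through the non-burning vertices $j$ from the largest to the smallest with respect to $\prec$, and for each of them through the unburnt copies $e$ of $\{h,j\}$ in $G_{\mathbf x}$. If $\{h,j\}\in E(T)$ and $\ell(\{h,j\})$ equals the number of unburnt copies of $\{h,j\}$ other than $e$, then $j$ starts to burn, set $h=j$, and start a new scan; otherwise burn $e$ and increase $\beta_j$ by $1$. When a scan is completed: if $h\ne0$, replace $h$ by $\mathrm{par}_T(h)$ and start a new scan; if $h=0$, stop. Let $\sigma$ be the permutation with $\sigma(1)\prec\sigma(2)\prec\dots\prec\sigma(n)$.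 The output is $(\beta_{\sigma(1)},\dots,\beta_{\sigma(n)})$. **Theorem.** On every input $\alpha\in\mathrm{PF}(\mathbf x)$ the vector DFS-burning algorithm terminates, and associating to $\alpha$ its output $(T,\ell,\prec)$ defines a bijection $$\psi\colon\mathrm{PF}(\mathbf x)\to\left\{(T,\ell,\prec)\ :\ T\in\mathrm{RPT}(n+1),\ \prec\,\in\mathrm{AVO}(T),\ \ell\colon E(T)\to\mathbb N,\ \ell(e)\in\{0,1,\dots,\omega_{G_{\mathbf x}}(e)-1\}\text{ for all }e\in E(T)\right\}.$$ It satisfies $\mathrm{rsum}(\alpha)=\kappa(G_{\mathbf x},T,\prec)+\sum_{e\in E(T)}\ell(e)$ when $(T,\ell,\prec)=\psi(\alpha)$. On every triple of the right-hand set the vector DFS-burning inverse algorithm terminates, and its output is the image of the triple under $\psi^{-1}$. -/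

import Mathlib

/-! Conventions. The vertex set `{0, 1, …, n}` is `Fin (n + 1)`, with root `0`. The non-root
vertices `1, …, n` are the `i.succ` with `i : Fin n`; sequences indexed by `1, …, n` are functions
on `Fin n`, and a relation on the non-root vertices is a relation on `Fin n`. -/

namespace VectorParking

/-! ### Vector parking functions -/

/-- `α` is an `x`-parking function: its weakly increasing rearrangement `α_{i_1} ≤ ⋯ ≤ α_{i_n}`
satisfies `α_{i_j} ≤ (x_1 + ⋯ + x_j) - 1` (as integers) for all `j`. -/
def IsParking {n : ℕ} (x α : Fin n → ℕ) : Prop :=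
  ∀ j : Fin n, ((α (Tuple.sort α j) : ℕ) : ℤ) ≤ (∑ k ∈ Finset.Iic j, (x k : ℤ)) - 1

/-- The set `PF(x)` of `x`-parking functions. -/
def PF {n : ℕ} (x : Fin n → ℕ) : Set (Fin n → ℕ) := {α | IsParking x α}

/-- The reversed sum `(∑_{i=1}^n (n+1-i) x_i) - n - ∑_i α_i`. With `i : Fin n` standing for the
index `i + 1`, the coefficient is `n - i`. -/
def rsum {n : ℕ} (x α : Fin n → ℕ) : ℤ :=
  (∑ i : Fin n, ((n : ℤ) - (i.val : ℤ)) * (x i : ℤ)) - (n : ℤ) - ∑ i : Fin n, (α i : ℤ)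

/-! ### Multigraphs -/

/-- A loopless multigraph with vertex set `V`, given by its edge-weight function. -/
structure Multigraph (V : Type) where
  /-- the multiplicity of each edge -/
  weight : Sym2 V → ℕ
  /-- there are no loops -/
  weight_loop : ∀ v : V, weight s(v, v) = 0

/-- The multiset of edges: it contains `weight e` copies of each `e`. -/
def Multigraph.edges {V : Type} [Fintype V] [DecidableEq V] (G : Multigraph V) :
    Multiset (Sym2 V) :=
  ∑ e : Sym2 V, Multiset.replicate (G.weight e) e

/-- `next x k` is `x_{k+1}` in the 1-based numbering, for `0 ≤ k < n`. (The value for `k ≥ n` is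
never used: it would be the multiplicity of an edge whose smaller endpoint is the last vertex.) -/
def next {n : ℕ} (x : Fin n → ℕ) (k : ℕ) : ℕ := if h : k < n then x ⟨k, h⟩ else 0

/-- The multigraph `G_x` on `{0, …, n}`, with `x_{min(i,j)+1}` edges between `i` and `j ≠ i`. -/
def Gx {n : ℕ} (x : Fin n → ℕ) : Multigraph (Fin (n + 1)) where
  weight := Sym2.lift ⟨fun i j => if i = j then 0 else next x (min i.val j.val), by
    intro i j
    simp only [eq_comm (a := i) (b := j), min_comm i.val j.val]⟩
  weight_loop := by
    intro v
    simp

/-! ### Rooted trees -/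

/-- The order `i ≤_T j`: the path in `T` from `j` to the root `0` passes through `i`. -/
def TreeLE {n : ℕ} (T : SimpleGraph (Fin (n + 1))) (i j : Fin (n + 1)) : Prop :=
  ∃ p : T.Walk j 0, p.IsPath ∧ i ∈ p.support

/-- `i` is an ancestor of `j`, equivalently `j` is a descendant of `i`. -/
def Ancestor {n : ℕ} (T : SimpleGraph (Fin (n + 1))) (i j : Fin (n + 1)) : Prop :=
  TreeLE T i j ∧ i ≠ j

/-- `i` is the parent of `j`: `j` is a descendant of `i`, and no descendant of `i` is an ancestor
of `j`. -/
def IsParent {n : ℕ} (T : SimpleGraph (Fin (n + 1))) (i j : Fin (n + 1)) : Prop :=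
  Ancestor T i j ∧ ¬ ∃ k, Ancestor T i k ∧ Ancestor T k j

open Classical in
/-- The parent `par_T(j)` of a non-root vertex `j`. (The value at the root is never used.) -/
noncomputable def par {n : ℕ} (T : SimpleGraph (Fin (n + 1))) (j : Fin (n + 1)) : Fin (n + 1) :=
  if h : ∃ i, IsParent T i j then h.choose else 0

/-- `T ∈ RPT(n+1)`: a rooted plane tree, as a tree on `{0, …, n}` labelled in depth-first order. -/
def IsRootedPlaneTree {n : ℕ} (T : SimpleGraph (Fin (n + 1))) : Prop :=
  T.IsTree ∧
  (∀ i j : Fin (n + 1), i ≠ 0 → j ≠ 0 → TreeLE T i j → i ≤ j) ∧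
  (∀ i j k : Fin (n + 1), i ≠ 0 → i < j → j < k → TreeLE T i k → TreeLE T i j)

/-- `≺ ∈ AVO(T)`: a total order on the non-root vertices such that `j ≺ i` whenever `i < j` are
siblings. -/
def IsAdmissibleOrder {n : ℕ} (T : SimpleGraph (Fin (n + 1))) (lt : Fin n → Fin n → Prop) : Prop :=
  IsStrictTotalOrder (Fin n) lt ∧
  ∀ i j : Fin n, i < j → par T i.succ = par T j.succ → lt j i

open Classical in
/-- The number `κ(G, T, ≺)`: the sum of `ω_G({par_T(i), j})` over the pairs of non-root vertices
with `i ≤_T j` and `j ≺ i`. -/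
noncomputable def kappa {n : ℕ} (G : Multigraph (Fin (n + 1))) (T : SimpleGraph (Fin (n + 1)))
    (lt : Fin n → Fin n → Prop) : ℕ :=
  ∑ i : Fin n, ∑ j : Fin n,
    if TreeLE T i.succ j.succ ∧ lt j i then G.weight s(par T i.succ, j.succ) else 0

/-- The data `(T, ℓ, ≺)`: a graph on `{0, …, n}`, a labelling of its edges by natural numbers, and
a relation on the non-root vertices. -/
structure Triple (n : ℕ) where
  /-- the graph `T` -/
  tree : SimpleGraph (Fin (n + 1))
  /-- the edge labelling `ℓ` -/
  label : tree.edgeSet → ℕ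
  /-- the relation `≺` -/
  lt : Fin n → Fin n → Prop

open Classical in
/-- The sum of all edge labels. -/
noncomputable def Triple.labelSum {n : ℕ} (t : Triple n) : ℕ := ∑ e : t.tree.edgeSet, t.label e

/-- The set of triples `(T, ℓ, ≺)` with `T ∈ RPT(n+1)`, `≺ ∈ AVO(T)` and
`ℓ(e) ∈ {0, 1, …, ω_{G_x}(e) - 1}` for every edge `e` of `T`. -/
def Triples {n : ℕ} (x : Fin n → ℕ) : Set (Triple n) :=
  {t | IsRootedPlaneTree t.tree ∧ IsAdmissibleOrder t.tree t.lt ∧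
    ∀ e : t.tree.edgeSet, t.label e < (Gx x).weight e}

/-! ### The algorithms

Each algorithm is a deterministic machine `step : State → Option State`, which halts when `step`
returns `none`; `StateTransition.eval` runs it until it halts. A set of copies of edges, such as
`burnt_edges`, is a multiset of edges. The field `todo` is the program position: it holds the
vertices `j` that the outer loop `for all j ∉ burning_vertices, in order from max to min` has not
finished with. Its maximum is the current `j`, and as long as there is an unburnt copy of
`{head, j}` the inner loop `for all e = {head, j} ∈ E(G) - burnt_edges` continues. -/

open Classical in
/-- The maximum of the finite set `s` with respect to `lt`, or `none` if there is none. -/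
noncomputable def maxOf {n : ℕ} (lt : Fin n → Fin n → Prop) (s : Finset (Fin n)) :
    Option (Fin n) :=
  if h : ∃ j ∈ s, ∀ k ∈ s, k ≠ j → lt k j then some h.choose else none

/-- The vertices that are not burning (the root always burns). -/
def notBurning {n : ℕ} (burning : Finset (Fin (n + 1))) : Finset (Fin n) :=
  Finset.univ.filter fun j => j.succ ∉ burning

/-- The state of the vector DFS-burning algorithm. -/
structure BurnState (n : ℕ) where
  /-- the multiset `E(G)` of edges added so far -/
  edges : Multiset (Sym2 (Fin (n + 1)))
  /-- `burning_vertices`, which is also the vertex set `V(T)` -/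
  burning : Finset (Fin (n + 1))
  /-- `burnt_edges` -/
  burnt : Multiset (Sym2 (Fin (n + 1)))
  /-- `counter`, the number of non-root vertices that burn -/
  counter : ℕ
  /-- the map `σ`, of which only the values at `0, …, counter` have a meaning -/
  perm : ℕ → Fin (n + 1)
  /-- the edges of `T` -/
  tree : SimpleGraph (Fin (n + 1))
  /-- the labelling `ℓ`, of which only the values at the edges of `T` have a meaning -/
  label : Sym2 (Fin (n + 1)) → ℕ
  /-- `head` -/
  head : Fin (n + 1)
  /-- the current value of `α` -/
  chips : Fin n → ℕ
  /-- the vertices that the current run of the outer loop still has to treat -/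
  todo : Finset (Fin n)

/-- The initial state: `0` burns, and `x_1` edges join it to every other vertex. -/
def burnInit {n : ℕ} (x α : Fin n → ℕ) : BurnState n where
  edges := ∑ k : Fin n, Multiset.replicate (next x 0) s(0, k.succ)
  burning := {0}
  burnt := 0
  counter := 0
  perm := fun _ => 0
  tree := ⊥
  label := fun _ => 0
  head := 0
  chips := α
  todo := notBurning {0}

/-- The vertex `j` starts to burn along an edge `{head, j}`. -/
def ignite {n : ℕ} (x : Fin n → ℕ) (s : BurnState n) (j : Fin n) : BurnState n :=
  let e := s(s.head, j.succ)
  let burning := insert j.succ s.burning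
  let counter := s.counter + 1
  let edges := s.edges +
    ∑ k ∈ notBurning burning, Multiset.replicate (next x counter) s(j.succ, k.succ)
  { edges := edges
    burning := burning
    burnt := s.burnt
    counter := counter
    perm := Function.update s.perm counter j.succ
    tree := s.tree ⊔ SimpleGraph.edge s.head j.succ
    label := Function.update s.label e ((edges - (s.burnt + {e})).count e)
    head := j.succ
    chips := s.chips
    todo := notBurning burning }

/-- One step of the vector DFS-burning algorithm. -/
noncomputable def burnStep {n : ℕ} (x : Fin n → ℕ) (s : BurnState n) : Option (BurnState n) :=
  match maxOf (· < ·) s.todo with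
  | some j =>
    if s(s.head, j.succ) ∈ s.edges - s.burnt then
      if 1 ≤ s.chips j then
        some { s with
          burnt := s.burnt + {s(s.head, j.succ)}
          chips := Function.update s.chips j (s.chips j - 1) }
      else some (ignite x s j)
    else some { s with todo := s.todo.erase j }
  | none =>
    if s.head ≠ 0 then
      some { s with head := par s.tree s.head, todo := notBurning s.burning }
    else none

/-- The result of a final state: the vertices of `T` are relabelled by `v ↦ σ⁻¹(v)`, so that
`a, b ∈ {0, …, counter}` are joined in the result if and only if `σ(a), σ(b)` are joined in `T`, and
the relabelled edge `{a, b}` keeps the label of `{σ(a), σ(b)}`; the order is given by `i ≺ j` if and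
only if `σ(i) < σ(j)`. -/
def burnOutput {n : ℕ} (s : BurnState n) : Triple n where
  tree :=
    { Adj := fun a b => a.val ≤ s.counter ∧ b.val ≤ s.counter ∧
        s.tree.Adj (s.perm a.val) (s.perm b.val)
      symm := ⟨fun _ _ h => ⟨h.2.1, h.1, h.2.2.symm⟩⟩
      loopless := ⟨fun _ h => h.2.2.ne rfl⟩ }
  label := fun e => s.label (Sym2.map (fun a : Fin (n + 1) => s.perm a.val) e.val)
  lt := fun i j => i.succ.val ≤ s.counter ∧ j.succ.val ≤ s.counter ∧
    s.perm i.succ.val < s.perm j.succ.val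

/-- The vector DFS-burning algorithm with respect to `x`, on input `α`. -/
noncomputable def vectorDFS {n : ℕ} (x α : Fin n → ℕ) : Part (Triple n) :=
  (StateTransition.eval (burnStep x) (burnInit x α)).map burnOutput

/-- The state of the multigraph DFS-burning inverse algorithm. -/
structure UnburnState (n : ℕ) where
  /-- `burning_vertices` -/
  burning : Finset (Fin (n + 1))
  /-- `burnt_edges` -/
  burnt : Multiset (Sym2 (Fin (n + 1)))
  /-- the current value of `α` -/
  chips : Fin n → ℕ
  /-- `head` -/
  head : Fin (n + 1)
  /-- the vertices that the current run of the outer loop still has to treat -/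
  todo : Finset (Fin n)

/-- The initial state: only `0` burns, and there are no chips. -/
def unburnInit (n : ℕ) : UnburnState n where
  burning := {0}
  burnt := 0
  chips := fun _ => 0
  head := 0
  todo := notBurning {0}

open Classical in
/-- One step of the multigraph DFS-burning inverse algorithm on input `(T, ℓ)`, with respect to the
multigraph `G` and the order `≺`, where `t = (T, ℓ, ≺)`. -/
noncomputable def unburnStep {n : ℕ} (G : Multigraph (Fin (n + 1))) (t : Triple n)
    (s : UnburnState n) : Option (UnburnState n) :=
  match maxOf t.lt s.todo with
  | some j =>
    if s(s.head, j.succ) ∈ G.edges - s.burnt then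
      if ∃ h : s(s.head, j.succ) ∈ t.tree.edgeSet, t.label ⟨s(s.head, j.succ), h⟩ =
          (G.edges - (s.burnt + {s(s.head, j.succ)})).count s(s.head, j.succ) then
        some { s with
          burning := insert j.succ s.burning
          head := j.succ
          todo := notBurning (insert j.succ s.burning) }
      else
        some { s with
          burnt := s.burnt + {s(s.head, j.succ)}
          chips := Function.update s.chips j (s.chips j + 1) }
    else some { s with todo := s.todo.erase j }
  | none =>
    if s.head ≠ 0 then
      some { s with head := par t.tree s.head, todo := notBurning s.burning }
    else none

/-- The multigraph DFS-burning inverse algorithm. -/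
noncomputable def multigraphInverse {n : ℕ} (G : Multigraph (Fin (n + 1))) (t : Triple n) :
    Part (Fin n → ℕ) :=
  (StateTransition.eval (unburnStep G t) (unburnInit n)).map fun s => s.chips

open Classical in
/-- The permutation `σ` with `σ(1) ≺ σ(2) ≺ ⋯ ≺ σ(n)`; it exists and is unique if `≺` is a total
order. -/
noncomputable def sortPerm {n : ℕ} (lt : Fin n → Fin n → Prop) : Equiv.Perm (Fin n) :=
  if h : ∃ σ : Equiv.Perm (Fin n), ∀ i j : Fin n, i < j → lt (σ i) (σ j) then h.choose else 1

/-- The vector DFS-burning inverse algorithm with respect to `x`: if `β` is the result of the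
multigraph inverse algorithm for `G_x` and `≺`, the output is `(β_{σ(1)}, …, β_{σ(n)})`. -/
noncomputable def vectorInverse {n : ℕ} (x : Fin n → ℕ) (t : Triple n) : Part (Fin n → ℕ) :=
  (multigraphInverse (Gx x) t).map fun β => β ∘ sortPerm t.lt

end VectorParking

/-!
Number the vertices in the order in which they start to burn, and let `p` be the parent function of
the tree in this numbering. Scans run from the largest to the smallest vertex, so for a vertex `j`
that does not burn yet, the edges to `j` from a burning vertex are

* all burnt, if this vertex is not an ancestor of the head,
* all burnt or all unburnt, if it is a proper ancestor `p i` of the head, `i` being its child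
  towards the head, according to whether `σ i < j` or `j < σ i`.

Each burnt edge to `j` has cost one chip. Hence, if `j` is the `k`-th vertex to burn,
`α_j + 1 + ℓ({p k, k}) + ∑ x_{p i + 1} = x_1 + ⋯ + x_k`,
where the sum is over the ancestors `i` of `k` with `j < σ i`. It is the contribution of `k` to `κ`.
This equation determines `α` from `(T, ℓ, ≺)`; it makes `α` a parking function; and its sum over `k`
is the formula for `rsum`.

Conversely, let `β` be the output of the inverse algorithm on a triple. That algorithm and the
burning algorithm on `β` run in lockstep: the chips placed on a vertex so far are as many as the
burning algorithm has removed, and when an unburnt edge to the vertex is found, they fall short of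
the final number if and only if the vertex does not start to burn. So the burning algorithm rebuilds
the triple from `β`.
-/

namespace VectorParking

/-! ### Parent functions -/

/-- `Anc p i k`: iterating the parent function `p` from `k` reaches `i`. The iteration stops at `0`,
so `p 0` plays no role. -/
def Anc (p : ℕ → ℕ) (i k : ℕ) : Prop := Relation.ReflTransGen (fun a b => 0 < a ∧ p a = b) k i

section Anc

variable {p q : ℕ → ℕ} {c i j k : ℕ}

lemma Anc.refl : Anc p k k := Relation.ReflTransGen.refl

lemma anc_iff : Anc p i k ↔ i = k ∨ 0 < k ∧ Anc p i (p k) := by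
  refine Relation.ReflTransGen.cases_head_iff.trans (or_congr eq_comm ⟨?_, ?_⟩)
  · rintro ⟨_, ⟨hk, rfl⟩, h⟩
    exact ⟨hk, h⟩
  · rintro ⟨hk, h⟩
    exact ⟨_, ⟨hk, rfl⟩, h⟩

lemma Anc.step (hk : 0 < k) (h : Anc p i (p k)) : Anc p i k :=
  Relation.ReflTransGen.head ⟨hk, rfl⟩ h

lemma Anc.parent (hk : 0 < k) : Anc p (p k) k := Anc.step hk Anc.refl

lemma Anc.trans (hij : Anc p i j) (hjk : Anc p j k) : Anc p i k :=
  Relation.ReflTransGen.trans hjk hij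

lemma Anc.eq_zero (h : Anc p i 0) : i = 0 :=
  (anc_iff.1 h).resolve_right fun h' => lt_irrefl _ h'.1

lemma Anc.of_ne (h : Anc p i k) (hne : i ≠ k) : Anc p i (p k) :=
  ((anc_iff.1 h).resolve_left hne).2

lemma Anc.exists_child (h : Anc p i k) (hne : i ≠ k) : ∃ l, 0 < l ∧ Anc p l k ∧ p l = i := by
  obtain rfl | ⟨l, hlk, hl, hpl⟩ := Relation.ReflTransGen.cases_tail h
  · exact absurd rfl hne
  · exact ⟨l, hl, hlk, hpl⟩

lemma Anc.total (hi : Anc p i k) (hj : Anc p j k) : Anc p i j ∨ Anc p j i :=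
  (Relation.ReflTransGen.total_of_right_unique (fun _ _ _ h h' => h.2.symm.trans h'.2) hi hj).symm

lemma Anc.le (hp : ∀ k, 0 < k → p k < k) (h : Anc p i k) : i ≤ k := by
  induction h with
  | refl => exact le_rfl
  | tail _ hab ih => exact (hab.2 ▸ hp _ hab.1).le.trans ih

lemma Anc.le_parent (hp : ∀ k, 0 < k → p k < k) (h : Anc p i k) (hne : i ≠ k) : i ≤ p k :=
  (h.of_ne hne).le hp

lemma anc_root (hp : ∀ k, 0 < k → p k < k) (k : ℕ) : Anc p 0 k := by
  induction k using Nat.strong_induction_on with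
  | _ k ih =>
    obtain rfl | hk := Nat.eq_zero_or_pos k
    · exact Anc.refl
    · exact Anc.step hk (ih _ (hp k hk))

lemma Anc.eq_of_parent_eq (hp : ∀ k, 0 < k → p k < k) (hi : Anc p i k) (hj : Anc p j k)
    (hi0 : 0 < i) (hj0 : 0 < j) (h : p i = p j) : i = j := by
  have not_anc : ∀ {a b}, 0 < a → p a = p b → a ≠ b → ¬ Anc p a b := fun ha hab hne hanc =>
    absurd (hanc.le_parent hp hne) (hab ▸ hp _ ha).not_ge
  by_contra hne
  exact (hi.total hj).elim (not_anc hi0 h hne) (not_anc hj0 h.symm (Ne.symm hne))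

lemma anc_congr (hp : ∀ k, 0 < k → p k < k) (h : ∀ k ≤ c, p k = q k) (hk : k ≤ c) :
    Anc p i k ↔ Anc q i k := by
  induction k using Nat.strong_induction_on with
  | _ k ih =>
    rw [anc_iff, anc_iff (p := q), ← h k hk]
    exact or_congr_right (and_congr_right fun h0 => ih _ (hp k h0) ((hp k h0).le.trans hk))

/-- The parent function `p` numbers `0, …, c` in depth-first order: if `i` is an ancestor of `k`, it
is an ancestor of everything between `i` and `k`. -/
def IsPreorder (c : ℕ) (p : ℕ → ℕ) : Prop :=
  ∀ i j k, 0 < i → i < j → j < k → k ≤ c → Anc p i k → Anc p i j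

lemma IsPreorder.succ (h : IsPreorder c p)
    (hlast : ∀ i, 0 < i → Anc p i (p (c + 1)) → ∀ j, i ≤ j → j ≤ c → Anc p i j) :
    IsPreorder (c + 1) p := by
  intro i j k hi hij hjk hk hik
  obtain hk | rfl := Nat.le_add_one_iff.1 hk
  · exact h i j k hi hij hjk hk hik
  · exact hlast i hi (hik.of_ne (by omega)) j hij.le (by omega)

open Classical in
lemma sum_anc_eq (hp : ∀ k, 0 < k → p k < k) (hk : k ≤ c) (f : ℕ → ℕ) :
    ∑ a ∈ Finset.range (c + 1) with Anc p a k, f a =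
      f k + ∑ i ∈ Finset.range (c + 1) with 0 < i ∧ Anc p i k, f (p i) := by
  have hanc : (Finset.range (c + 1)).filter (Anc p · k) =
      insert k (((Finset.range (c + 1)).filter fun i => 0 < i ∧ Anc p i k).image p) := by
    ext a
    simp only [Finset.mem_filter, Finset.mem_range, Nat.lt_add_one_iff, Finset.mem_insert,
      Finset.mem_image]
    constructor
    · rintro ⟨-, ha⟩
      refine or_iff_not_imp_left.2 fun hne => ?_
      obtain ⟨i, hi, hik, rfl⟩ := ha.exists_child hne
      exact ⟨i, ⟨(hik.le hp).trans hk, hi, hik⟩, rfl⟩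
    · rintro (rfl | ⟨i, ⟨hic, hi, hik⟩, rfl⟩)
      · exact ⟨hk, Anc.refl⟩
      · exact ⟨(hp i hi).le.trans hic, (Anc.parent hi).trans hik⟩
  rw [hanc, Finset.sum_insert, Finset.sum_image]
  · intro i hi j hj hij
    simp only [Finset.mem_coe, Finset.mem_filter] at hi hj
    exact Anc.eq_of_parent_eq hp hi.2.2 hj.2.2 hi.2.1 hj.2.1 hij
  · simp only [Finset.mem_image, Finset.mem_filter, not_exists, not_and, and_imp]
    intro i _ hi hik hpi
    exact absurd (hik.le hp) (hpi ▸ hp i hi).not_ge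

end Anc

/-! ### Trees given by a parent function -/

/-- The graph `T` is the rooted tree on the distinct vertices `σ 0 = 0, σ 1, …, σ c` in which the
parent of `σ k` is `σ (p k)`; the other vertices are isolated. -/
structure IsRooted {n : ℕ} (T : SimpleGraph (Fin (n + 1))) (c : ℕ) (σ : ℕ → Fin (n + 1))
    (p : ℕ → ℕ) : Prop where
  zero : σ 0 = 0
  inj : ∀ a ≤ c, ∀ b ≤ c, σ a = σ b → a = b
  lt : ∀ k, 0 < k → p k < k
  adj : ∀ u v, T.Adj u v ↔ ∃ k, 0 < k ∧ k ≤ c ∧ (u = σ k ∧ v = σ (p k) ∨ u = σ (p k) ∧ v = σ k)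

namespace IsRooted

variable {n : ℕ} {T : SimpleGraph (Fin (n + 1))} {c : ℕ} {σ : ℕ → Fin (n + 1)} {p : ℕ → ℕ}

lemma parent_le (h : IsRooted T c σ p) {k : ℕ} (h0 : 0 < k) (hk : k ≤ c) : p k ≤ c :=
  (h.lt k h0).le.trans hk

lemma adj_parent (h : IsRooted T c σ p) {k : ℕ} (h0 : 0 < k) (hk : k ≤ c) :
    T.Adj (σ k) (σ (p k)) :=
  (h.adj _ _).2 ⟨k, h0, hk, Or.inl ⟨rfl, rfl⟩⟩

lemma parent_or_child_of_adj (h : IsRooted T c σ p) {k : ℕ} (hk : k ≤ c) {v : Fin (n + 1)}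
    (hv : T.Adj (σ k) v) :
    (0 < k ∧ v = σ (p k)) ∨ ∃ l, 0 < l ∧ l ≤ c ∧ p l = k ∧ v = σ l := by
  obtain ⟨l, l0, lc, ⟨hkl, hv⟩ | ⟨hkl, hv⟩⟩ := (h.adj _ _).1 hv
  · obtain rfl := h.inj k hk l lc hkl
    exact Or.inl ⟨l0, hv⟩
  · exact Or.inr ⟨l, l0, lc, (h.inj k hk _ (h.parent_le l0 lc) hkl).symm, hv⟩

lemma adj_iff (h : IsRooted T c σ p) {a b : ℕ} (hab : a < b) (hb : b ≤ c) :
    T.Adj (σ a) (σ b) ↔ p b = a := by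
  constructor
  · intro hadj
    obtain ⟨a0, hba⟩ | ⟨l, -, lc, hl, hbl⟩ := h.parent_or_child_of_adj (hab.le.trans hb) hadj
    · have := h.lt a a0
      have := h.inj b hb (p a) (by omega) hba
      omega
    · rwa [h.inj b hb l lc hbl]
  · rintro rfl
    exact (h.adj_parent (by omega) hb).symm

lemma lt_of_forall_ne (h : IsRooted T c σ p) {v : Fin (n + 1)} (hv : ∀ a ≤ c, σ a ≠ v) : c < n := by
  have hcard := Finset.card_le_univ (insert v ((Finset.range (c + 1)).image σ))
  rw [Finset.card_insert_of_notMem, Finset.card_image_of_injOn, Finset.card_range,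
    Fintype.card_fin] at hcard
  · omega
  · intro a ha b hb hab
    simp only [Finset.coe_range, Set.mem_Iio, Nat.lt_add_one_iff] at ha hb
    exact h.inj a ha b hb hab
  · simpa only [Finset.mem_image, Finset.mem_range, Nat.lt_add_one_iff, not_exists, not_and]
      using hv

lemma congr_parent (h : IsRooted T c σ p) {q : ℕ → ℕ} (hq : ∀ k, 0 < k → q k < k)
    (hpq : ∀ k ≤ c, p k = q k) : IsRooted T c σ q := by
  refine ⟨h.zero, h.inj, hq, fun u v => (h.adj u v).trans (exists_congr fun k => ?_)⟩
  exact and_congr_right fun _ => and_congr_right fun hk => by rw [hpq k hk]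

lemma sup_edge (h : IsRooted T c σ p) {v : Fin (n + 1)} (hv : ∀ a ≤ c, σ a ≠ v) :
    IsRooted (T ⊔ SimpleGraph.edge (σ (p (c + 1))) v) (c + 1) (Function.update σ (c + 1) v) p := by
  have hold : ∀ a ≤ c, Function.update σ (c + 1) v a = σ a := fun a ha =>
    Function.update_of_ne (by omega) _ _
  have hnew : Function.update σ (c + 1) v (c + 1) = v := Function.update_self _ _ _
  have hpc : p (c + 1) ≤ c := Nat.lt_add_one_iff.1 (h.lt (c + 1) (Nat.succ_pos c))
  have hedge : ∀ u w, (SimpleGraph.edge (σ (p (c + 1))) v).Adj u w ↔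
      u = v ∧ w = σ (p (c + 1)) ∨ u = σ (p (c + 1)) ∧ w = v := by
    have hne := hv _ hpc
    intro u w
    rw [SimpleGraph.edge_adj]
    grind
  refine ⟨(hold 0 (Nat.zero_le c)).trans h.zero, fun a ha b hb hab => ?_, h.lt, fun u w => ?_⟩
  · obtain ha | rfl := Nat.le_add_one_iff.1 ha <;> obtain hb | rfl := Nat.le_add_one_iff.1 hb
    · rw [hold a ha, hold b hb] at hab
      exact h.inj a ha b hb hab
    · rw [hold a ha, hnew] at hab
      exact absurd hab (hv a ha)
    · rw [hold b hb, hnew] at hab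
      exact absurd hab.symm (hv b hb)
    · rfl
  · rw [SimpleGraph.sup_adj, h.adj, hedge]
    constructor
    · rintro (⟨k, hk0, hk, huw⟩ | huw)
      · refine ⟨k, hk0, hk.trans (Nat.le_succ c), ?_⟩
        rwa [hold k hk, hold _ (h.parent_le hk0 hk)]
      · exact ⟨c + 1, Nat.succ_pos c, le_rfl, by rwa [hnew, hold _ hpc]⟩
    · rintro ⟨k, hk0, hk, huw⟩
      obtain hk | rfl := Nat.le_add_one_iff.1 hk
      · rw [hold k hk, hold _ (h.parent_le hk0 hk)] at huw
        exact Or.inl ⟨k, hk0, hk, huw⟩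
      · exact Or.inr (by rwa [hnew, hold _ hpc] at huw)

lemma mem_support_of_anc (h : IsRooted T c σ p) {u w : Fin (n + 1)} (q : T.Walk u w) (hw : w = 0)
    {i k : ℕ} (hk : k ≤ c) (hu : u = σ k) (hi : Anc p i k) : σ i ∈ q.support := by
  induction q generalizing k i with
  | nil =>
    obtain rfl := h.inj k hk 0 (Nat.zero_le _) (by rw [← hu, hw, h.zero])
    rw [hi.eq_zero, SimpleGraph.Walk.support_nil, List.mem_singleton, hu]
  | @cons u v w hadj q ih =>
    subst hu
    rw [SimpleGraph.Walk.support_cons, List.mem_cons]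
    obtain ⟨k0, hv⟩ | ⟨l, l0, lc, hl, hv⟩ := h.parent_or_child_of_adj hk hadj
    · obtain rfl | ⟨-, hi⟩ := anc_iff.1 hi
      · exact Or.inl rfl
      · exact Or.inr (ih hw (h.parent_le k0 hk) hv hi)
    · exact Or.inr (ih hw lc hv (Anc.step l0 (hl ▸ hi)))

lemma exists_anc_of_mem_support (h : IsRooted T c σ p) {u w : Fin (n + 1)} (q : T.Walk u w)
    (hq : q.IsPath) (hw : w = 0) {k : ℕ} (hk : k ≤ c) (hu : u = σ k) {v : Fin (n + 1)}
    (hv : v ∈ q.support) : ∃ i, Anc p i k ∧ v = σ i := by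
  induction q generalizing k v with
  | nil =>
    rw [SimpleGraph.Walk.support_nil, List.mem_singleton] at hv
    exact ⟨k, Anc.refl, hv.trans hu⟩
  | @cons u y w hadj q ih =>
    subst hu
    rw [SimpleGraph.Walk.cons_isPath_iff] at hq
    rw [SimpleGraph.Walk.support_cons, List.mem_cons] at hv
    obtain rfl | hv := hv
    · exact ⟨k, Anc.refl, rfl⟩
    obtain ⟨k0, hy⟩ | ⟨l, l0, lc, hl, hy⟩ := h.parent_or_child_of_adj hk hadj
    · obtain ⟨i, hi, hvi⟩ := ih hq.1 hw (h.parent_le k0 hk) hy hv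
      exact ⟨i, Anc.step k0 hi, hvi⟩
    · exact absurd (h.mem_support_of_anc q hw lc hy (hl ▸ Anc.parent l0)) hq.2

lemma reachable_root (h : IsRooted T c σ p) {k : ℕ} (hk : k ≤ c) : T.Reachable (σ k) 0 := by
  induction k using Nat.strong_induction_on with
  | _ k ih =>
    obtain rfl | k0 := Nat.eq_zero_or_pos k
    · rw [h.zero]
    · exact (h.adj_parent k0 hk).reachable.trans (ih _ (h.lt k k0) (h.parent_le k0 hk))

lemma treeLE_iff_exists (h : IsRooted T c σ p) {k : ℕ} (hk : k ≤ c) {v : Fin (n + 1)} :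
    TreeLE T v (σ k) ↔ ∃ i, Anc p i k ∧ v = σ i := by
  constructor
  · rintro ⟨q, hq, hv⟩
    exact h.exists_anc_of_mem_support q hq rfl hk rfl hv
  · rintro ⟨i, hi, rfl⟩
    obtain ⟨q⟩ := h.reachable_root hk
    classical
    exact ⟨q.toPath, q.toPath.2, h.mem_support_of_anc _ rfl hk rfl hi⟩

lemma treeLE_iff (h : IsRooted T c σ p) {i k : ℕ} (hi : i ≤ c) (hk : k ≤ c) :
    TreeLE T (σ i) (σ k) ↔ Anc p i k := by
  rw [h.treeLE_iff_exists hk]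
  constructor
  · rintro ⟨j, hj, hij⟩
    rwa [h.inj i hi j ((hj.le h.lt).trans hk) hij]
  · exact fun hik => ⟨i, hik, rfl⟩

lemma ancestor_iff (h : IsRooted T c σ p) {k : ℕ} (hk : k ≤ c) {v : Fin (n + 1)} :
    Ancestor T v (σ k) ↔ ∃ i, Anc p i k ∧ i ≠ k ∧ v = σ i := by
  rw [Ancestor, h.treeLE_iff_exists hk]
  constructor
  · rintro ⟨⟨i, hi, rfl⟩, hne⟩
    exact ⟨i, hi, ne_of_apply_ne σ hne, rfl⟩
  · rintro ⟨i, hi, hne, rfl⟩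
    exact ⟨⟨i, hi, rfl⟩, mt (h.inj _ ((hi.le h.lt).trans hk) _ hk) hne⟩

lemma isParent_iff (h : IsRooted T c σ p) {k : ℕ} (k0 : 0 < k) (hk : k ≤ c) {v : Fin (n + 1)} :
    IsParent T v (σ k) ↔ v = σ (p k) := by
  have hpk : Ancestor T (σ (p k)) (σ k) :=
    (h.ancestor_iff hk).2 ⟨p k, Anc.parent k0, (h.lt k k0).ne, rfl⟩
  constructor
  · rintro ⟨hv, hno⟩
    obtain ⟨i, hi, hik, rfl⟩ := (h.ancestor_iff hk).1 hv
    by_contra hne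
    exact hno ⟨σ (p k), (h.ancestor_iff (h.parent_le k0 hk)).2
      ⟨i, hi.of_ne hik, ne_of_apply_ne σ hne, rfl⟩, hpk⟩
  · rintro rfl
    refine ⟨hpk, ?_⟩
    rintro ⟨w, hpw, hwk⟩
    obtain ⟨i, hi, hik, rfl⟩ := (h.ancestor_iff hk).1 hwk
    have hic := (hi.le h.lt).trans hk
    obtain ⟨l, hl, hli, hlk⟩ := (h.ancestor_iff hic).1 hpw
    have := hi.le_parent h.lt hik
    have := hl.le h.lt
    have := h.inj (p k) (h.parent_le k0 hk) l (by omega) hlk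
    omega

lemma par_eq (h : IsRooted T c σ p) {k : ℕ} (k0 : 0 < k) (hk : k ≤ c) :
    par T (σ k) = σ (p k) := by
  have hex : ∃ i, IsParent T i (σ k) := ⟨_, (h.isParent_iff k0 hk).2 rfl⟩
  rw [par, dif_pos hex]
  exact (h.isParent_iff k0 hk).1 hex.choose_spec

end IsRooted

/-! ### Rooted plane trees -/

/-- The vertex `k` of `{0, …, n}`. (For `k > n` it is `k` modulo `n + 1`, which is never used.) -/
abbrev vert (n : ℕ) (k : ℕ) : Fin (n + 1) := Fin.ofNat (n + 1) k

section vert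

variable {n a b k : ℕ}

lemma vert_val (a : Fin (n + 1)) : vert n a.val = a := by
  ext
  simp

lemma val_vert (hk : k ≤ n) : (vert n k).val = k := by
  simp [Nat.mod_eq_of_lt (Nat.lt_succ_of_le hk)]

lemma vert_succ (j : Fin n) : vert n (j.val + 1) = j.succ := by
  rw [← Fin.val_succ, vert_val]

lemma vert_zero (n : ℕ) : vert n 0 = 0 := by
  ext
  simp

lemma vert_inj (ha : a ≤ n) (hb : b ≤ n) (h : vert n a = vert n b) : a = b := by
  rw [← val_vert ha, ← val_vert hb, h]

lemma vert_lt_vert (hab : a < b) (hb : b ≤ n) : vert n a < vert n b := by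
  rwa [Fin.lt_def, val_vert (hab.le.trans hb), val_vert hb]

lemma vert_ne_zero (hk : 0 < k) (hkn : k ≤ n) : vert n k ≠ 0 :=
  (vert_zero n ▸ vert_lt_vert hk hkn).ne'

end vert

lemma isTree_adj_iff_snd {V : Type*} {T : SimpleGraph V} (hT : T.IsTree) {r : V}
    {q : ∀ a, T.Walk a r} (hq : ∀ a, (q a).IsPath) {a b : V} :
    T.Adj a b ↔ (a ≠ r ∧ (q a).snd = b) ∨ (b ≠ r ∧ (q b).snd = a) := by
  have snd_eq : ∀ {a b}, T.Adj a b → b ∈ (q a).support → a ≠ r ∧ (q a).snd = b := by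
    intro a b hab hb
    refine ⟨?_, (hT.isAcyclic.eq_snd_of_adj_start (hq a) hab hb).symm⟩
    rintro rfl
    rw [(SimpleGraph.Walk.isPath_iff_nil.1 (hq a)).eq_nil, SimpleGraph.Walk.support_nil,
      List.mem_singleton] at hb
    exact hab.ne hb.symm
  have adj_snd : ∀ {a}, a ≠ r → T.Adj a (q a).snd := fun ha =>
    SimpleGraph.Walk.adj_snd (SimpleGraph.Walk.not_nil_of_ne ha)
  constructor
  · intro hab
    by_cases ha : a ∈ (q b).support
    · exact Or.inr (snd_eq hab.symm ha)
    · have hb := hT.isAcyclic.mem_support_of_ne_mem_support_of_adj_of_isPath (hq a).reverse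
        (hq b).reverse hab (by rwa [SimpleGraph.Walk.support_reverse, List.mem_reverse])
      rw [SimpleGraph.Walk.support_reverse, List.mem_reverse] at hb
      exact Or.inl (snd_eq hab hb)
  · rintro (⟨ha, rfl⟩ | ⟨hb, rfl⟩)
    · exact adj_snd ha
    · exact (adj_snd hb).symm

section

variable {n : ℕ} {T : SimpleGraph (Fin (n + 1))} {p : ℕ → ℕ}

/-- The edge from the vertex `j + 1` to its parent `p (j + 1)`. -/
def parentEdge (n : ℕ) (p : ℕ → ℕ) (j : Fin n) : Sym2 (Fin (n + 1)) :=
  s(vert n (p (j.val + 1)), j.succ)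

lemma IsRooted.parentEdge_mem (h : IsRooted T n (vert n) p) (j : Fin n) :
    parentEdge n p j ∈ T.edgeSet := by
  have := (h.adj_parent (Nat.succ_pos j.val) j.isLt).symm
  rwa [vert_succ] at this

lemma parentEdge_injective (hp : ∀ k, 0 < k → p k < k) : Function.Injective (parentEdge n p) := by
  intro i j hij
  obtain ⟨-, hij⟩ | ⟨hi, hj⟩ := Sym2.eq_iff.1 hij
  · exact Fin.succ_injective _ hij
  · have hpi := hp (i.val + 1) (Nat.succ_pos _)
    have hpj := hp (j.val + 1) (Nat.succ_pos _)
    rw [Fin.ext_iff, val_vert (by omega), Fin.val_succ] at hi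
    rw [Fin.ext_iff, val_vert (by omega), Fin.val_succ] at hj
    omega

lemma IsRooted.exists_parentEdge_eq (h : IsRooted T n (vert n) p) {e : Sym2 (Fin (n + 1))}
    (he : e ∈ T.edgeSet) : ∃ j, parentEdge n p j = e := by
  induction e using Sym2.ind with
  | _ u v =>
    obtain ⟨k, k0, kn, hk⟩ := (h.adj _ _).1 he
    have hk1 : k - 1 + 1 = k := by omega
    have hsucc : (⟨k - 1, by omega⟩ : Fin n).succ = vert n k := by
      rw [← vert_succ, hk1]
    refine ⟨⟨k - 1, by omega⟩, ?_⟩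
    rw [parentEdge, hsucc, hk1]
    obtain ⟨rfl, rfl⟩ | ⟨rfl, rfl⟩ := hk
    · exact Sym2.eq_swap
    · rfl

lemma IsRooted.parentEdge_bijective (h : IsRooted T n (vert n) p) :
    Function.Bijective fun j : Fin n => (⟨parentEdge n p j, h.parentEdge_mem j⟩ : T.edgeSet) :=
  ⟨fun _ _ hij => parentEdge_injective h.lt (Subtype.ext_iff.1 hij),
    fun ⟨_, he⟩ => (h.exists_parentEdge_eq he).imp fun _ hj => Subtype.ext hj⟩

lemma IsRooted.isTree (h : IsRooted T n (vert n) p) : T.IsTree := by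
  rw [SimpleGraph.isTree_iff_connected_and_card]
  constructor
  · refine (SimpleGraph.connected_iff_exists_forall_reachable T).2 ⟨0, fun v => ?_⟩
    rw [← vert_val v]
    exact (h.reachable_root (Nat.le_of_lt_succ v.isLt)).symm
  · rw [← Nat.card_congr (Equiv.ofBijective _ h.parentEdge_bijective), Nat.card_fin, Nat.card_fin]

lemma IsRooted.treeLE_iff_val (h : IsRooted T n (vert n) p) (i j : Fin (n + 1)) :
    TreeLE T i j ↔ Anc p i.val j.val := by
  rw [← h.treeLE_iff (Nat.le_of_lt_succ i.isLt) (Nat.le_of_lt_succ j.isLt), vert_val, vert_val]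

lemma IsRooted.isRootedPlaneTree (h : IsRooted T n (vert n) p) (hpre : IsPreorder n p) :
    IsRootedPlaneTree T := by
  simp only [IsRootedPlaneTree, h.treeLE_iff_val]
  exact ⟨h.isTree, fun _ _ _ _ hij => hij.le h.lt, fun i j k hi hij hjk hik =>
    hpre _ _ _ (Fin.pos_of_ne_zero hi) hij hjk (Nat.le_of_lt_succ k.isLt) hik⟩

lemma isTree_exists_isRooted (hT : T.IsTree)
    (hle : ∀ i j : Fin (n + 1), i ≠ 0 → j ≠ 0 → TreeLE T i j → i ≤ j) :
    ∃ p, IsRooted T n (vert n) p := by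
  choose q hq using fun a : Fin (n + 1) => (hT.existsUnique_path a 0).exists
  have adj_iff := fun a b => isTree_adj_iff_snd hT hq (a := a) (b := b)
  have snd_lt : ∀ a, a ≠ 0 → (q a).snd < a := by
    intro a ha
    by_cases h0 : (q a).snd = 0
    · rw [h0]
      exact Fin.pos_of_ne_zero ha
    · have hadj : T.Adj a (q a).snd := (adj_iff _ _).2 (Or.inl ⟨ha, rfl⟩)
      exact (hle _ _ h0 ha ⟨q a, hq a, (q a).getVert_mem_support 1⟩).lt_of_ne hadj.ne'
  refine ⟨fun k => if k ≤ n then ((q (vert n k)).snd).val else 0, vert_zero n,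
    fun a ha b hb => vert_inj ha hb, fun k k0 => ?_, fun u v => (adj_iff u v).trans ⟨?_, ?_⟩⟩
  · split_ifs with hk
    · simpa only [Fin.lt_def, val_vert hk] using snd_lt _ (vert_ne_zero k0 hk)
    · exact k0
  · rintro (⟨h0, rfl⟩ | ⟨h0, rfl⟩)
    · exact ⟨u, Fin.pos_of_ne_zero h0, Nat.le_of_lt_succ u.isLt, Or.inl (by
        rw [if_pos (Nat.le_of_lt_succ u.isLt), vert_val, vert_val]
        exact ⟨rfl, rfl⟩)⟩
    · exact ⟨v, Fin.pos_of_ne_zero h0, Nat.le_of_lt_succ v.isLt, Or.inr (by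
        rw [if_pos (Nat.le_of_lt_succ v.isLt), vert_val, vert_val]
        exact ⟨rfl, rfl⟩)⟩
  · rintro ⟨k, k0, kn, huv⟩
    rw [if_pos kn, vert_val] at huv
    obtain ⟨rfl, rfl⟩ | ⟨rfl, rfl⟩ := huv
    · exact Or.inl ⟨vert_ne_zero k0 kn, rfl⟩
    · exact Or.inr ⟨vert_ne_zero k0 kn, rfl⟩

lemma IsRootedPlaneTree.exists_isRooted (hT : IsRootedPlaneTree T) :
    ∃ p, IsRooted T n (vert n) p ∧ IsPreorder n p := by
  obtain ⟨htree, hle, hpre⟩ := hT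
  obtain ⟨p, hp⟩ := isTree_exists_isRooted htree hle
  refine ⟨p, hp, fun i j k i0 hij hjk hkn hik => ?_⟩
  rw [← hp.treeLE_iff (by omega) (by omega)] at hik ⊢
  exact hpre _ _ _ (vert_ne_zero i0 (by omega)) (vert_lt_vert hij (by omega))
    (vert_lt_vert hjk hkn) hik

end

/-! ### Runs of deterministic machines -/

lemma exists_halting {S Γ M : Type*} [LT M] [WellFoundedLT M] (f : S → Option S)
    (Inv : S → Γ → Prop) (μ : S → Γ → M)
    (hstep : ∀ s g, Inv s g → f s = none ∨ ∃ s' g', f s = some s' ∧ Inv s' g' ∧ μ s' g' < μ s g)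
    (s : S) (g : Γ) (hs : Inv s g) :
    ∃ s' g', StateTransition.Reaches f s s' ∧ f s' = none ∧ Inv s' g' := by
  induction hm : μ s g using WellFoundedLT.induction generalizing s g with
  | _ m ih =>
    obtain hnone | ⟨s', g', hsome, hs', hlt⟩ := hstep s g hs
    · exact ⟨s, g, Relation.ReflTransGen.refl, hnone, hs⟩
    · obtain ⟨t, g'', hreach, ht⟩ := ih _ (hm ▸ hlt) s' g' hs' rfl
      exact ⟨t, g'', Relation.ReflTransGen.head hsome hreach, ht⟩

lemma reaches_of_step {S : Type*} {f : S → Option S} {s s' t : S}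
    (h : StateTransition.Reaches f s t) (ht : f t = none) (hs : f s = some s') :
    StateTransition.Reaches f s' t := by
  obtain rfl | ⟨u, hu : f s = some u, hut⟩ := Relation.ReflTransGen.cases_head h
  · exact absurd (ht.symm.trans hs) (Option.some_ne_none s').symm
  · exact Option.some.inj (hu.symm.trans hs) ▸ hut

lemma eval_eq_some {S : Type*} {f : S → Option S} {s t : S}
    (h : StateTransition.Reaches f s t) (ht : f t = none) :
    StateTransition.eval f s = Part.some t :=
  Part.eq_some_iff.2 (StateTransition.mem_eval.2 ⟨h, ht⟩)

/-- The quantity that decreases lexicographically in each step of both algorithms: the number `a` of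
vertices that do not burn, the number `b` of unburnt edges, the number `h` of the head, and the
number `d` of vertices that the current scan has not finished with. -/
def scanMeasure (a b h d : ℕ) : ℕ ×ₗ ℕ ×ₗ ℕ ×ₗ ℕ := toLex (a, toLex (b, toLex (h, d)))

section scanMeasure

variable {a a' b b' h h' d d' : ℕ}

lemma scanMeasure_lt_of_ignite (ha : a' < a) : scanMeasure a' b' h' d' < scanMeasure a b h d :=
  Prod.Lex.toLex_lt_toLex.2 (Or.inl ha)

lemma scanMeasure_lt_of_burn (hb : b' < b) : scanMeasure a b' h' d' < scanMeasure a b h d :=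
  Prod.Lex.toLex_lt_toLex.2 (Or.inr ⟨rfl, Prod.Lex.toLex_lt_toLex.2 (Or.inl hb)⟩)

lemma scanMeasure_lt_of_backtrack (hh : h' < h) : scanMeasure a b h' d' < scanMeasure a b h d :=
  Prod.Lex.toLex_lt_toLex.2 (Or.inr ⟨rfl, Prod.Lex.toLex_lt_toLex.2 (Or.inr ⟨rfl,
    Prod.Lex.toLex_lt_toLex.2 (Or.inl hh)⟩)⟩)

lemma scanMeasure_lt_of_skip (hd : d' < d) : scanMeasure a b h d' < scanMeasure a b h d :=
  Prod.Lex.toLex_lt_toLex.2 (Or.inr ⟨rfl, Prod.Lex.toLex_lt_toLex.2 (Or.inr ⟨rfl,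
    Prod.Lex.toLex_lt_toLex.2 (Or.inr ⟨rfl, hd⟩)⟩)⟩)

end scanMeasure

/-! ### Maxima and multiplicities -/

lemma exists_last {V : Type*} (lt : V → V → Prop) [IsStrictTotalOrder V lt] {s : Finset V}
    (hs : s.Nonempty) : ∃ j ∈ s, ∀ k ∈ s, k ≠ j → lt k j := by
  classical
  let _ := linearOrderOfSTO lt
  exact ⟨s.max' hs, s.max'_mem _, fun k hk hkj => lt_of_le_of_ne (s.le_max' k hk) hkj⟩

section maxOf

variable {n : ℕ} {lt : Fin n → Fin n → Prop} [IsStrictTotalOrder (Fin n) lt] {s : Finset (Fin n)}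
  {j : Fin n}

lemma maxOf_eq_some : maxOf lt s = some j ↔ j ∈ s ∧ ∀ k ∈ s, k ≠ j → lt k j := by
  unfold maxOf
  constructor
  · intro h
    split_ifs at h with hex
    exact Option.some.inj h ▸ hex.choose_spec
  · intro h
    have hex : ∃ j ∈ s, ∀ k ∈ s, k ≠ j → lt k j := ⟨j, h⟩
    rw [dif_pos hex, Option.some.injEq]
    by_contra hne
    exact asymm (h.2 _ hex.choose_spec.1 hne) (hex.choose_spec.2 _ h.1 (Ne.symm hne))

lemma maxOf_eq_none : maxOf lt s = none ↔ s = ∅ := by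
  refine ⟨fun h => ?_, fun h => by simp [maxOf, h]⟩
  by_contra hne
  obtain ⟨j, hj⟩ := exists_last lt (Finset.nonempty_iff_ne_empty.2 hne)
  exact Option.some_ne_none j ((maxOf_eq_some.2 hj).symm.trans h)

lemma le_of_maxOf_eq_some (h : maxOf (· < ·) s = some j) {k : Fin n} (hk : k ∈ s) : k ≤ j := by
  by_contra hlt
  exact hlt ((maxOf_eq_some.1 h).2 k hk (fun h' => hlt h'.le)).le

end maxOf

lemma mem_notBurning {n : ℕ} {B : Finset (Fin (n + 1))} {j : Fin n} :
    j ∈ notBurning B ↔ j.succ ∉ B := by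
  simp [notBurning]

lemma mk_eq_mk_iff_of_mem {V : Type*} {B : Finset V} {u v a b : V} (hu : u ∈ B) (hb : b ∉ B) :
    s(u, a) = s(v, b) ↔ u = v ∧ a = b := by
  rw [Sym2.eq_iff, or_iff_left]
  rintro ⟨rfl, -⟩
  exact hb hu

lemma mk_ne_mk_of_notMem {V : Type*} {B : Finset V} {u v a b : V} (hu : u ∈ B) (ha : a ∉ B)
    (hb : b ∉ B) : s(a, b) ≠ s(u, v) := by
  rw [Ne, Sym2.eq_iff]
  rintro (⟨rfl, -⟩ | ⟨-, rfl⟩)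
  · exact ha hu
  · exact hb hu

section star

variable {n : ℕ} (S : Finset (Fin n)) (m : ℕ)

lemma count_star (u : Fin (n + 1)) {k : Fin n} (hk : k ∈ S) :
    (∑ k ∈ S, Multiset.replicate m s(u, k.succ)).count s(u, k.succ) = m := by
  rw [Multiset.count_sum', Finset.sum_eq_single_of_mem k hk, Multiset.count_replicate_self]
  intro l _ hl
  rw [Multiset.count_replicate, if_neg]
  exact fun h => hl (Fin.succ_injective _ (Sym2.congr_right.1 h))

lemma count_star_of_ne {u v w : Fin (n + 1)} (hv : v ≠ u) (hw : w ≠ u) :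
    (∑ k ∈ S, Multiset.replicate m s(u, k.succ)).count s(v, w) = 0 := by
  rw [Multiset.count_sum', Finset.sum_eq_zero]
  intro l _
  rw [Multiset.count_replicate, if_neg]
  rw [Sym2.eq_iff]
  rintro (⟨h, -⟩ | ⟨h, -⟩)
  · exact hv h.symm
  · exact hw h.symm

end star

lemma mem_sub_iff_count_lt {V : Type*} [DecidableEq V] {A B : Multiset V} {e : V} :
    e ∈ A - B ↔ B.count e < A.count e := by
  rw [← Multiset.count_pos, Multiset.count_sub, Nat.sub_pos_iff_lt]

lemma card_sub_add_singleton_lt {V : Type*} [DecidableEq V] {A B : Multiset V} {e : V}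
    (h : e ∈ A - B) : (A - (B + {e})).card < (A - B).card := by
  rw [tsub_add_eq_tsub_tsub, Multiset.sub_singleton]
  exact Multiset.card_erase_lt_of_mem h

lemma Gx_weight {n : ℕ} (x : Fin n → ℕ) {a b : ℕ} (hab : a < b) (hb : b ≤ n) :
    (Gx x).weight s(vert n a, vert n b) = next x a := by
  have ha := hab.le.trans hb
  have hne : vert n a ≠ vert n b := fun h => hab.ne (vert_inj ha hb h)
  simp only [Gx, Sym2.lift_mk, if_neg hne, val_vert ha, val_vert hb, min_eq_left hab.le]

lemma count_edges {n : ℕ} (G : Multigraph (Fin (n + 1))) (e : Sym2 (Fin (n + 1))) :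
    G.edges.count e = G.weight e := by
  rw [Multigraph.edges, Multiset.count_sum', Finset.sum_eq_single_of_mem e (Finset.mem_univ e),
    Multiset.count_replicate_self]
  intro f _ hf
  rw [Multiset.count_replicate, if_neg hf]

/-! ### Moves of the burning algorithm -/

namespace BurnState

variable {n : ℕ}

/-- The move after a vertex `j` without unburnt edges to the head has been found: the scan goes on
with the next vertex. -/
def skip (s : BurnState n) (j : Fin n) : BurnState n := { s with todo := s.todo.erase j }

/-- The move after a completed scan at a head other than the root: the parent of the head becomes
the head. -/
noncomputable def backtrack (s : BurnState n) : BurnState n :=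
  { s with head := par s.tree s.head, todo := notBurning s.burning }

/-- The move that burns a copy of the edge `{head, j}` at the expense of a chip on `j`. -/
def burnEdge (s : BurnState n) (j : Fin n) : BurnState n :=
  { s with
    burnt := s.burnt + {s(s.head, j.succ)}
    chips := Function.update s.chips j (s.chips j - 1) }

lemma burnEdge_chips (s : BurnState n) (j : Fin n) :
    (s.burnEdge j).chips = Function.update s.chips j (s.chips j - 1) := rfl

/-- The number of burnt copies of the edge between the `a`-th burning vertex and `j`. -/
def burntCount (s : BurnState n) (a : ℕ) (j : Fin n) : ℕ := s.burnt.count s(s.perm a, j.succ)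

end BurnState

section burnStep

variable {n : ℕ} {x : Fin n → ℕ} {s : BurnState n} {j : Fin n}

lemma burnStep_of_head_eq_zero (htodo : s.todo = ∅) (hhead : s.head = 0) : burnStep x s = none := by
  simp only [burnStep, maxOf_eq_none.2 htodo, hhead, ne_eq, not_true_eq_false, if_false]

lemma burnStep_of_head_ne_zero (htodo : s.todo = ∅) (hhead : s.head ≠ 0) :
    burnStep x s = some s.backtrack := by
  simp only [burnStep, maxOf_eq_none.2 htodo, if_pos hhead, BurnState.backtrack]

lemma burnStep_of_notMem (hj : maxOf (· < ·) s.todo = some j)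
    (hav : s(s.head, j.succ) ∉ s.edges - s.burnt) : burnStep x s = some (s.skip j) := by
  simp only [burnStep, hj, if_neg hav, BurnState.skip]

lemma burnStep_of_pos (hj : maxOf (· < ·) s.todo = some j)
    (hav : s(s.head, j.succ) ∈ s.edges - s.burnt) (hchips : 1 ≤ s.chips j) :
    burnStep x s = some (s.burnEdge j) := by
  simp only [burnStep, hj, if_pos hav, if_pos hchips, BurnState.burnEdge]

lemma burnStep_of_eq_zero (hj : maxOf (· < ·) s.todo = some j)
    (hav : s(s.head, j.succ) ∈ s.edges - s.burnt) (hchips : s.chips j = 0) :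
    burnStep x s = some (ignite x s j) := by
  simp only [burnStep, hj, if_pos hav, hchips, if_neg Nat.one_pos.not_ge]

end burnStep

section ignite

variable {n : ℕ} {x : Fin n → ℕ} {s : BurnState n} {j : Fin n}

lemma ignite_perm_of_le {a : ℕ} (ha : a ≤ s.counter) : (ignite x s j).perm a = s.perm a :=
  Function.update_of_ne (by omega) _ _

lemma ignite_perm_self : (ignite x s j).perm (s.counter + 1) = j.succ :=
  Function.update_self _ _ _

lemma notMem_ignite_burning {v : Fin (n + 1)} :
    v ∉ (ignite x s j).burning ↔ v ≠ j.succ ∧ v ∉ s.burning := by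
  rw [ignite, Finset.mem_insert, not_or]

lemma ignite_edges_count {u v : Fin (n + 1)} (hu : u ≠ j.succ) (hv : v ≠ j.succ) :
    (ignite x s j).edges.count s(u, v) = s.edges.count s(u, v) := by
  rw [ignite, Multiset.count_add, count_star_of_ne _ _ hu hv, add_zero]

lemma ignite_label_of_mem (hj : j.succ ∉ s.burning) {u v : Fin (n + 1)} (hu : u ∈ s.burning)
    (hv : v ∈ s.burning) : (ignite x s j).label s(u, v) = s.label s(u, v) := by
  refine Function.update_of_ne ?_ _ _
  rw [Ne, Sym2.eq_iff]
  rintro (⟨-, rfl⟩ | ⟨rfl, -⟩)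
  · exact hj hv
  · exact hj hu

lemma ignite_burntCount_of_le {a : ℕ} (ha : a ≤ s.counter) (k : Fin n) :
    (ignite x s j).burntCount a k = s.burntCount a k := by
  rw [BurnState.burntCount, BurnState.burntCount, ignite_perm_of_le ha]
  rfl

end ignite

/-! ### The tree of the burning algorithm -/

/-- The part of the invariant of the burning algorithm that concerns its tree. Burning vertices are
numbered in the order in which they start to burn: `h` is the number of the head, and `p` is the
parent function of the tree in this numbering. -/
structure BurnTree {n : ℕ} (s : BurnState n) (h : ℕ) (p : ℕ → ℕ) : Prop where
  counter_le : s.counter ≤ n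
  rooted : IsRooted s.tree s.counter s.perm p
  mem_burning : ∀ v, v ∈ s.burning ↔ ∃ k ≤ s.counter, s.perm k = v
  h_le : h ≤ s.counter
  head : s.head = s.perm h
  dfs : ∀ i, 0 < i → Anc p i h → ∀ j, i ≤ j → j ≤ s.counter → Anc p i j
  preorder : IsPreorder s.counter p
  order : ∀ i k, 0 < i → i < k → k ≤ s.counter → p i = p k → s.perm k < s.perm i

namespace BurnTree

variable {n : ℕ} {x : Fin n → ℕ} {s : BurnState n} {h : ℕ} {p : ℕ → ℕ} {j : Fin n}

lemma initial (x α : Fin n → ℕ) {p : ℕ → ℕ} (hp : ∀ k, 0 < k → p k < k) :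
    BurnTree (burnInit x α) 0 p where
  counter_le := Nat.zero_le _
  rooted := by
    refine ⟨rfl, fun a ha b hb _ => (Nat.le_zero.1 ha).trans (Nat.le_zero.1 hb).symm, hp,
      fun u v => ⟨False.elim, ?_⟩⟩
    rintro ⟨k, hk0, hk, -⟩
    exact absurd hk hk0.not_ge
  mem_burning := fun v => by simp [burnInit, eq_comm]
  h_le := le_rfl
  head := rfl
  dfs := fun _ hi0 hi => absurd hi.eq_zero hi0.ne'
  preorder := fun _ _ _ _ _ hjk hk => absurd (hjk.trans_le hk) (Nat.not_lt_zero _)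
  order := fun _ _ _ hik hk => absurd (hik.trans_le hk) (Nat.not_lt_zero _)

lemma perm_mem (H : BurnTree s h p) {a : ℕ} (ha : a ≤ s.counter) : s.perm a ∈ s.burning :=
  (H.mem_burning _).2 ⟨a, ha, rfl⟩

lemma perm_ne (H : BurnTree s h p) {v : Fin (n + 1)} (hv : v ∉ s.burning) {a : ℕ}
    (ha : a ≤ s.counter) : s.perm a ≠ v :=
  fun h' => hv (h' ▸ H.perm_mem ha)

lemma counter_lt (H : BurnTree s h p) (hj : j.succ ∉ s.burning) : s.counter < n :=
  H.rooted.lt_of_forall_ne fun _ ha => H.perm_ne hj ha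

lemma head_eq_zero_iff (H : BurnTree s h p) : s.head = 0 ↔ h = 0 := by
  rw [H.head, ← H.rooted.zero]
  exact ⟨H.rooted.inj h H.h_le 0 (Nat.zero_le _), fun h' => h' ▸ rfl⟩

lemma congr_parent (H : BurnTree s h p) {q : ℕ → ℕ} (hq : ∀ k, 0 < k → q k < k)
    (hpq : ∀ k ≤ s.counter, p k = q k) : BurnTree s h q := by
  have hanc : ∀ {i k}, k ≤ s.counter → (Anc p i k ↔ Anc q i k) := anc_congr H.rooted.lt hpq
  refine { H with
    rooted := H.rooted.congr_parent hq hpq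
    dfs := fun i hi0 hi j hij hj => (hanc hj).1 (H.dfs i hi0 ((hanc H.h_le).2 hi) j hij hj)
    preorder := fun i j k hi0 hij hjk hk hik =>
      (hanc (hjk.le.trans hk)).1 (H.preorder i j k hi0 hij hjk hk ((hanc hk).2 hik))
    order := fun i k hi0 hik hk hpik => H.order i k hi0 hik hk ?_ }
  rwa [hpq i (hik.le.trans hk), hpq k hk]

lemma backtrack (H : BurnTree s h p) (hh : 0 < h) : BurnTree s.backtrack (p h) p :=
  { H with
    h_le := H.rooted.parent_le hh H.h_le
    head := (congrArg (par s.tree) H.head).trans (H.rooted.par_eq hh H.h_le)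
    dfs := fun i hi0 hi => H.dfs i hi0 (Anc.step hh hi) }

lemma ignite (H : BurnTree s h p) (hj : j.succ ∉ s.burning) (hpc : p (s.counter + 1) = h)
    (hchild : ∀ i, 0 < i → i ≤ s.counter → p i = h → j.succ < s.perm i) :
    BurnTree (ignite x s j) (s.counter + 1) p where
  counter_le := H.counter_lt hj
  rooted := by
    have hrooted := H.rooted.sup_edge fun _ ha => H.perm_ne hj ha
    rwa [hpc, ← H.head] at hrooted
  mem_burning := fun v => by
    refine Finset.mem_insert.trans ((or_congr Iff.rfl (H.mem_burning v)).trans ⟨?_, ?_⟩)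
    · rintro (rfl | ⟨k, hk, rfl⟩)
      · exact ⟨s.counter + 1, le_rfl, ignite_perm_self⟩
      · exact ⟨k, hk.trans (Nat.le_succ _), ignite_perm_of_le hk⟩
    · rintro ⟨k, hk, rfl⟩
      obtain hk | rfl := Nat.le_add_one_iff.1 hk
      · exact Or.inr ⟨k, hk, (ignite_perm_of_le hk).symm⟩
      · exact Or.inl ignite_perm_self
  h_le := le_rfl
  head := ignite_perm_self.symm
  dfs := fun i hi0 hi k hik hk => by
    obtain hk | rfl := Nat.le_add_one_iff.1 hk
    · exact H.dfs i hi0 (hpc ▸ hi.of_ne (by omega)) k hik hk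
    · exact hi
  preorder := H.preorder.succ fun i hi0 hi => H.dfs i hi0 (hpc ▸ hi)
  order := fun i k hi0 hik hk hpik => by
    obtain hk | rfl := Nat.le_add_one_iff.1 hk
    · rw [ignite_perm_of_le hk, ignite_perm_of_le (hik.le.trans hk)]
      exact H.order i k hi0 hik hk hpik
    · have hic : i ≤ s.counter := Nat.lt_add_one_iff.1 hik
      rw [ignite_perm_self, ignite_perm_of_le hic]
      exact hchild i hi0 hic (hpik.trans hpc)

lemma burnEdge_burntCount (H : BurnTree s h p) (hj : j.succ ∉ s.burning) {a : ℕ}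
    (ha : a ≤ s.counter) (k : Fin n) :
    (s.burnEdge j).burntCount a k = s.burntCount a k + if a = h ∧ k = j then 1 else 0 := by
  simp only [BurnState.burntCount, BurnState.burnEdge, Multiset.count_add,
    Multiset.count_singleton, H.head]
  congr 1
  refine if_congr ?_ rfl rfl
  rw [mk_eq_mk_iff_of_mem (H.perm_mem ha) hj, Fin.succ_inj]
  exact and_congr_left' ⟨H.rooted.inj a ha h H.h_le, fun h' => h' ▸ rfl⟩

lemma burnEdge_burntCount_of_ne (H : BurnTree s h p) (hj : j.succ ∉ s.burning) {a : ℕ}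
    (ha : a ≤ s.counter) {k : Fin n} (hne : ¬ (a = h ∧ k = j)) :
    (s.burnEdge j).burntCount a k = s.burntCount a k := by
  rw [H.burnEdge_burntCount hj ha, if_neg hne, add_zero]

end BurnTree

/-! ### Chips and burnt edges in the burning algorithm -/

/-- The part of the invariant of the burning algorithm on the input `α` that relates edges and
chips: each burnt edge to a vertex `j` that does not burn has cost `j` one of its chips. -/
structure BurnCounts {n : ℕ} (x α : Fin n → ℕ) (s : BurnState n) : Prop where
  edges : ∀ a ≤ s.counter, ∀ j : Fin n, j.succ ∉ s.burning →
    s.edges.count s(s.perm a, j.succ) = next x a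
  edges_zero : ∀ v w, v ∉ s.burning → w ∉ s.burning → s.edges.count s(v, w) = 0
  burnt_zero : ∀ v w, v ∉ s.burning → w ∉ s.burning → s.burnt.count s(v, w) = 0
  burnt_le : ∀ a ≤ s.counter, ∀ j : Fin n, j.succ ∉ s.burning → s.burntCount a j ≤ next x a
  chips : ∀ j : Fin n, j.succ ∉ s.burning →
    s.chips j + ∑ a ∈ Finset.range (s.counter + 1), s.burntCount a j = α j

namespace BurnCounts

variable {n : ℕ} {x α : Fin n → ℕ} {s : BurnState n} {h : ℕ} {p : ℕ → ℕ} {j : Fin n}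

lemma initial (x α : Fin n → ℕ) : BurnCounts x α (burnInit x α) where
  edges := by
    intro a ha j _
    obtain rfl : a = 0 := Nat.le_zero.1 ha
    exact count_star _ _ _ (Finset.mem_univ j)
  edges_zero := fun v w hv hw => count_star_of_ne Finset.univ (next x 0)
    (fun h => hv (Finset.mem_singleton.2 h)) (fun h => hw (Finset.mem_singleton.2 h))
  burnt_zero := fun _ _ _ _ => Multiset.count_zero _
  burnt_le := fun a _ j _ => (Multiset.count_zero _).trans_le (Nat.zero_le _)
  chips := fun j _ => by simp [burnInit, BurnState.burntCount]

lemma mem_edges_sub_burnt_iff (C : BurnCounts x α s) (H : BurnTree s h p)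
    (hj : j.succ ∉ s.burning) :
    s(s.head, j.succ) ∈ s.edges - s.burnt ↔ s.burntCount h j < next x h := by
  rw [mem_sub_iff_count_lt, H.head, C.edges h H.h_le j hj, BurnState.burntCount]

lemma sum_burnEdge_burntCount (H : BurnTree s h p) (hj : j.succ ∉ s.burning) (k : Fin n) :
    ∑ a ∈ Finset.range (s.counter + 1), (s.burnEdge j).burntCount a k =
      ∑ a ∈ Finset.range (s.counter + 1), s.burntCount a k + if k = j then 1 else 0 := by
  have hcount : ∀ a ∈ Finset.range (s.counter + 1), (s.burnEdge j).burntCount a k =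
      s.burntCount a k + if a = h then (if k = j then 1 else 0) else 0 := fun a ha => by
    rw [H.burnEdge_burntCount hj (Finset.mem_range_succ_iff.1 ha), ite_and]
  rw [Finset.sum_congr rfl hcount, Finset.sum_add_distrib, Finset.sum_ite_eq',
    if_pos (Finset.mem_range_succ_iff.2 H.h_le)]

lemma burnEdge (C : BurnCounts x α s) (H : BurnTree s h p) (hj : j.succ ∉ s.burning)
    (hav : s(s.head, j.succ) ∈ s.edges - s.burnt) (hchips : 1 ≤ s.chips j) :
    BurnCounts x α (s.burnEdge j) := by
  refine { C with burnt_zero := fun v w hv hw => ?_, burnt_le := fun a ha k hk => ?_,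
                  chips := fun k hk => ?_ }
  · rw [BurnState.burnEdge, Multiset.count_add, C.burnt_zero v w hv hw, Multiset.count_singleton,
      if_neg (mk_ne_mk_of_notMem (H.head ▸ H.perm_mem H.h_le) hv hw)]
  · rw [H.burnEdge_burntCount hj ha]
    split_ifs with hak
    · obtain ⟨rfl, rfl⟩ := hak
      exact (C.mem_edges_sub_burnt_iff H hj).1 hav
    · exact C.burnt_le a ha k hk
  · refine (congrArg _ (sum_burnEdge_burntCount H hj k)).trans ?_
    rw [← C.chips k hk]
    by_cases hkj : k = j
    · subst hkj
      rw [BurnState.burnEdge_chips, Function.update_self, if_pos rfl]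
      omega
    · rw [BurnState.burnEdge_chips, Function.update_of_ne hkj, if_neg hkj, add_zero]

lemma ignite_burntCount_self (C : BurnCounts x α s) (hj : j.succ ∉ s.burning) {k : Fin n}
    (hk : k.succ ∉ s.burning) : (ignite x s j).burntCount (s.counter + 1) k = 0 := by
  rw [BurnState.burntCount, ignite_perm_self]
  exact C.burnt_zero _ _ hj hk

lemma ignite (C : BurnCounts x α s) (H : BurnTree s h p) (hj : j.succ ∉ s.burning) :
    BurnCounts x α (ignite x s j) where
  edges := fun a ha k hk => by
    obtain ⟨hkj, hkB⟩ := notMem_ignite_burning.1 hk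
    obtain ha | rfl := Nat.le_add_one_iff.1 ha
    · rw [ignite_perm_of_le ha, ignite_edges_count (H.perm_ne hj ha) hkj, C.edges a ha k hkB]
    · rw [ignite_perm_self, VectorParking.ignite, Multiset.count_add, C.edges_zero _ _ hj hkB,
        zero_add]
      exact count_star _ _ _ (mem_notBurning.2 hk)
  edges_zero := fun v w hv hw => by
    obtain ⟨hvj, hvB⟩ := notMem_ignite_burning.1 hv
    obtain ⟨hwj, hwB⟩ := notMem_ignite_burning.1 hw
    rw [ignite_edges_count hvj hwj, C.edges_zero v w hvB hwB]
  burnt_zero := fun v w hv hw =>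
    C.burnt_zero v w (notMem_ignite_burning.1 hv).2 (notMem_ignite_burning.1 hw).2
  burnt_le := fun a ha k hk => by
    have hkB := (notMem_ignite_burning.1 hk).2
    obtain ha | rfl := Nat.le_add_one_iff.1 ha
    · exact (ignite_burntCount_of_le ha k).trans_le (C.burnt_le a ha k hkB)
    · exact (C.ignite_burntCount_self hj hkB).trans_le (Nat.zero_le _)
  chips := fun k hk => by
    have hkB := (notMem_ignite_burning.1 hk).2
    rw [show (VectorParking.ignite x s j).counter = s.counter + 1 from rfl, Finset.sum_range_succ,
      C.ignite_burntCount_self hj hkB, add_zero, ← C.chips k hkB]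
    exact congrArg _ (Finset.sum_congr rfl fun a ha =>
      ignite_burntCount_of_le (Finset.mem_range_succ_iff.1 ha) k)

/-- When `j` starts to burn, the edge `e` along which it does so is neither burnt nor counted in the
label, hence the `1`. -/
lemma ignite_label_self (C : BurnCounts x α s) (H : BurnTree s h p) (hj : j.succ ∉ s.burning)
    (hav : s(s.head, j.succ) ∈ s.edges - s.burnt) :
    s.burntCount h j + (1 + (VectorParking.ignite x s j).label s(s.perm h, j.succ)) = next x h := by
  have hedges : (VectorParking.ignite x s j).edges.count s(s.perm h, j.succ) = next x h := by
    rw [VectorParking.ignite, Multiset.count_add, C.edges h H.h_le j hj, Multiset.count_sum',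
      Finset.sum_eq_zero, add_zero]
    intro k hk
    have hkB : k.succ ∉ s.burning :=
      (notMem_ignite_burning (x := x).1 (mem_notBurning.1 hk)).2
    rw [Multiset.count_replicate, if_neg]
    rw [Sym2.eq_swap, Sym2.congr_left]
    exact (H.perm_ne hkB H.h_le).symm
  have hlabel : (VectorParking.ignite x s j).label s(s.head, j.succ) =
      ((VectorParking.ignite x s j).edges - (s.burnt + {s(s.head, j.succ)})).count
        s(s.head, j.succ) := Function.update_self _ _ _
  rw [C.mem_edges_sub_burnt_iff H hj, BurnState.burntCount] at hav
  rw [← H.head, hlabel, H.head, Multiset.count_sub, hedges, Multiset.count_add,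
    Multiset.count_singleton_self, BurnState.burntCount]
  omega

end BurnCounts

/-! ### The pattern of burnt edges -/

/-- The part of the invariant of the burning algorithm that says which edges to the vertices that do
not burn are burnt. Since scans run from the largest to the smallest vertex, the edges at a proper
ancestor of the head are burnt exactly to the vertices above the child through which the search has
left this ancestor. -/
structure BurntPattern {n : ℕ} (x : Fin n → ℕ) (s : BurnState n) (h : ℕ) (p : ℕ → ℕ) : Prop where
  todo : ∀ j ∈ s.todo, j.succ ∉ s.burning
  sibling_full : ∀ i, 0 < i → i ≤ s.counter → ∀ j : Fin n, j.succ ∉ s.burning →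
    s.perm i < j.succ → s.burntCount (p i) j = next x (p i)
  anc_zero : ∀ i, 0 < i → Anc p i h → ∀ j : Fin n, j.succ ∉ s.burning →
    j.succ < s.perm i → s.burntCount (p i) j = 0
  done_full : ∀ a ≤ s.counter, ¬ Anc p a h → ∀ j : Fin n, j.succ ∉ s.burning →
    s.burntCount a j = next x a
  todo_full : ∀ j : Fin n, j.succ ∉ s.burning → j ∉ s.todo → s.burntCount h j = next x h
  todo_fresh : ∀ j : Fin n, j.succ ∉ s.burning → ∀ k ∈ s.todo, j < k → s.burntCount h j = 0 ∨
    ∃ i, 0 < i ∧ i ≤ s.counter ∧ p i = h ∧ s.perm i < j.succ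

namespace BurntPattern

variable {n : ℕ} {x α : Fin n → ℕ} {s : BurnState n} {h : ℕ} {p : ℕ → ℕ} {j : Fin n}

lemma initial (x α : Fin n → ℕ) (p : ℕ → ℕ) : BurntPattern x (burnInit x α) 0 p where
  todo := fun _ hj => mem_notBurning.1 hj
  sibling_full := fun _ hi0 hi => absurd hi hi0.not_ge
  anc_zero := fun _ hi0 hi => absurd hi.eq_zero hi0.ne'
  done_full := fun _ ha hna => absurd (Nat.le_zero.1 ha ▸ Anc.refl) hna
  todo_full := fun _ hj hj' => absurd (mem_notBurning.2 hj) hj'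
  todo_fresh := fun _ _ _ _ _ => Or.inl (Multiset.count_zero _)

lemma congr_parent (P : BurntPattern x s h p) (H : BurnTree s h p) {q : ℕ → ℕ}
    (hq : ∀ k, 0 < k → q k < k) (hpq : ∀ k ≤ s.counter, p k = q k) : BurntPattern x s h q := by
  have hanc : ∀ {i}, Anc p i h ↔ Anc q i h := anc_congr H.rooted.lt hpq H.h_le
  refine { P with
    sibling_full := fun i hi0 hi => hpq i hi ▸ P.sibling_full i hi0 hi
    anc_zero := fun i hi0 hi => hpq i ((hi.le hq).trans H.h_le) ▸ P.anc_zero i hi0 (hanc.2 hi)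
    done_full := fun _ ha hna => P.done_full _ ha (hna ∘ hanc.1)
    todo_fresh := fun j hj k hk hjk => (P.todo_fresh j hj k hk hjk).imp_right ?_ }
  rintro ⟨i, hi0, hi, hpi, hij⟩
  exact ⟨i, hi0, hi, hpq i hi ▸ hpi, hij⟩

lemma skip (P : BurntPattern x s h p) (hj : s.burntCount h j = next x h) :
    BurntPattern x (s.skip j) h p := by
  refine { P with
    todo := fun k hk => P.todo k (Finset.mem_of_mem_erase hk)
    todo_full := fun k hk hk' => ?_
    todo_fresh := fun k hk l hl => P.todo_fresh k hk l (Finset.mem_of_mem_erase hl) }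
  by_cases hkj : k = j
  · exact hkj ▸ hj
  · exact P.todo_full k hk fun hkt => hk' (Finset.mem_erase.2 ⟨hkj, hkt⟩)

lemma backtrack (P : BurntPattern x s h p) (H : BurnTree s h p) (htodo : s.todo = ∅)
    (hh : 0 < h) : BurntPattern x s.backtrack (p h) p := by
  refine { P with
    todo := fun j hj => mem_notBurning.1 hj
    anc_zero := fun i hi0 hi => P.anc_zero i hi0 (Anc.step hh hi)
    done_full := fun a ha hna j hj => ?_
    todo_full := fun j hj hj' => absurd (mem_notBurning.2 hj) hj'
    todo_fresh := fun j hj _ _ _ => ?_ }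
  · by_cases hah : a = h
    · subst hah
      exact P.todo_full j hj (htodo ▸ Finset.notMem_empty j)
    · exact P.done_full a ha (fun hanc => hna (hanc.of_ne hah)) j hj
  · obtain hlt | hlt := lt_or_gt_of_ne (H.perm_ne hj H.h_le)
    · exact Or.inr ⟨h, hh, H.h_le, rfl, hlt⟩
    · exact Or.inl (P.anc_zero h hh Anc.refl j hj hlt)

lemma burnEdge (P : BurntPattern x s h p) (H : BurnTree s h p) (hj : j ∈ s.todo)
    (hmax : ∀ k ∈ s.todo, k ≤ j) (hlt : s.burntCount h j < next x h) :
    BurntPattern x (s.burnEdge j) h p := by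
  have hjB := P.todo j hj
  refine { P with
    sibling_full := fun i hi0 hi k hk hik => ?_
    anc_zero := fun i hi0 hi k hk hik => ?_
    done_full := fun a ha hna k hk => ?_
    todo_full := fun k hk hk' => ?_
    todo_fresh := fun k hk l hl hkl => ?_ }
  · have hfull := P.sibling_full i hi0 hi k hk hik
    refine (H.burnEdge_burntCount_of_ne hjB (H.rooted.parent_le hi0 hi) ?_).trans hfull
    rintro ⟨hpi, rfl⟩
    exact hlt.ne (hpi ▸ hfull)
  · have hpi := (H.rooted.lt i hi0).trans_le (hi.le H.rooted.lt)
    refine (H.burnEdge_burntCount_of_ne hjB (hpi.le.trans H.h_le) fun h' => hpi.ne h'.1).trans ?_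
    exact P.anc_zero i hi0 hi k hk hik
  · refine (H.burnEdge_burntCount_of_ne hjB ha fun h' => hna (h'.1 ▸ Anc.refl)).trans ?_
    exact P.done_full a ha hna k hk
  · refine (H.burnEdge_burntCount_of_ne hjB H.h_le fun h' => hk' (h'.2 ▸ hj)).trans ?_
    exact P.todo_full k hk hk'
  · rw [H.burnEdge_burntCount_of_ne hjB H.h_le fun h' => (hkl.trans_le (hmax l hl)).ne h'.2]
    exact P.todo_fresh k hk l hl hkl

lemma lt_perm_of_parent_eq (P : BurntPattern x s h p) (H : BurnTree s h p)
    (hj : j.succ ∉ s.burning) (hlt : s.burntCount h j < next x h) {i : ℕ} (hi0 : 0 < i)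
    (hi : i ≤ s.counter) (hpi : p i = h) : j.succ < s.perm i := by
  refine (lt_or_gt_of_ne (H.perm_ne hj hi)).resolve_left fun hij => ?_
  exact hlt.ne (hpi ▸ P.sibling_full i hi0 hi j hj hij)

lemma ignite (P : BurntPattern x s h p) (C : BurnCounts x α s) (H : BurnTree s h p)
    (hj : j ∈ s.todo) (hmax : ∀ k ∈ s.todo, k ≤ j) (hlt : s.burntCount h j < next x h)
    (hpc : p (s.counter + 1) = h) : BurntPattern x (ignite x s j) (s.counter + 1) p where
  todo := fun k hk => mem_notBurning.1 hk
  sibling_full := fun i hi0 hi k hk hik => by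
    have hkB := (notMem_ignite_burning.1 hk).2
    obtain hi | rfl := Nat.le_add_one_iff.1 hi
    · rw [ignite_perm_of_le hi] at hik
      rw [ignite_burntCount_of_le (H.rooted.parent_le hi0 hi)]
      exact P.sibling_full i hi0 hi k hkB hik
    · rw [ignite_perm_self, Fin.succ_lt_succ_iff] at hik
      rw [hpc, ignite_burntCount_of_le H.h_le]
      exact P.todo_full k hkB fun hkt => (hmax k hkt).not_gt hik
  anc_zero := fun i hi0 hi k hk hik => by
    have hkB := (notMem_ignite_burning.1 hk).2
    by_cases hic : i = s.counter + 1
    · rw [hic, ignite_perm_self, Fin.succ_lt_succ_iff] at hik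
      rw [hic, hpc, ignite_burntCount_of_le H.h_le]
      refine (P.todo_fresh k hkB j hj hik).resolve_right ?_
      rintro ⟨l, hl0, hl, hpl, hlk⟩
      exact (hlk.trans (Fin.succ_lt_succ_iff.2 hik)).asymm
        (P.lt_perm_of_parent_eq H (P.todo j hj) hlt hl0 hl hpl)
    · have hih : Anc p i h := hpc ▸ hi.of_ne hic
      have hile := (hih.le H.rooted.lt).trans H.h_le
      rw [ignite_perm_of_le hile] at hik
      rw [ignite_burntCount_of_le (H.rooted.parent_le hi0 hile)]
      exact P.anc_zero i hi0 hih k hkB hik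
  done_full := fun a ha hna k hk => by
    obtain ha | rfl := Nat.le_add_one_iff.1 ha
    · rw [ignite_burntCount_of_le ha]
      refine P.done_full a ha (fun hah => hna (Anc.step (Nat.succ_pos _) ?_)) k
        (notMem_ignite_burning.1 hk).2
      rwa [hpc]
    · exact absurd Anc.refl hna
  todo_full := fun k hk hk' => absurd (mem_notBurning.2 hk) hk'
  todo_fresh := fun k hk _ _ _ =>
    Or.inl (C.ignite_burntCount_self (P.todo j hj) (notMem_ignite_burning.1 hk).2)

end BurntPattern

/-! ### The value of the input at a burning vertex -/

open Classical in
/-- The unburnt edges to a vertex `j` that does not burn: those at the head, and all edges at the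
proper ancestors of the head whose child towards the head is larger than `j`. -/
lemma BurntPattern.sum_next_eq {n : ℕ} {x α : Fin n → ℕ} {s : BurnState n} {h : ℕ} {p : ℕ → ℕ}
    {j : Fin n} (P : BurntPattern x s h p) (C : BurnCounts x α s) (H : BurnTree s h p)
    (hj : j.succ ∉ s.burning) :
    ∑ a ∈ Finset.range (s.counter + 1), next x a =
      ∑ a ∈ Finset.range (s.counter + 1), s.burntCount a j + (next x h - s.burntCount h j) +
      ∑ i ∈ Finset.range (s.counter + 1) with Anc p i h ∧ j.succ < s.perm i, next x (p i) := by
  let unburnt : ℕ → ℕ := fun a => next x a - s.burntCount a j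
  have hsplit : ∑ a ∈ Finset.range (s.counter + 1), next x a =
      ∑ a ∈ Finset.range (s.counter + 1), s.burntCount a j +
        ∑ a ∈ Finset.range (s.counter + 1), unburnt a := by
    rw [← Finset.sum_add_distrib]
    refine Finset.sum_congr rfl fun a ha => ?_
    exact (Nat.add_sub_of_le (C.burnt_le a (Finset.mem_range_succ_iff.1 ha) j hj)).symm
  have hanc : ∑ a ∈ Finset.range (s.counter + 1) with Anc p a h, unburnt a =
      ∑ a ∈ Finset.range (s.counter + 1), unburnt a := by
    refine Finset.sum_filter_of_ne fun a ha => not_imp_comm.1 fun hna => ?_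
    rw [Nat.sub_eq_zero_iff_le, P.done_full a (Finset.mem_range_succ_iff.1 ha) hna j hj]
  rw [hsplit, ← hanc, sum_anc_eq H.rooted.lt H.h_le, ← add_assoc, Finset.sum_filter,
    Finset.sum_filter]
  refine congrArg _ (Finset.sum_congr rfl fun i hi => ?_)
  have hic := Finset.mem_range_succ_iff.1 hi
  by_cases hih : 0 < i ∧ Anc p i h
  · obtain ⟨hi0, hih⟩ := hih
    obtain hij | hij := lt_or_gt_of_ne (H.perm_ne hj hic)
    · rw [if_pos ⟨hi0, hih⟩, if_neg fun h' => hij.asymm h'.2, Nat.sub_eq_zero_iff_le,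
        P.sibling_full i hi0 hic j hj hij]
    · rw [if_pos ⟨hi0, hih⟩, if_pos ⟨hih, hij⟩]
      simp only [unburnt, P.anc_zero i hi0 hih j hj hij, Nat.sub_zero]
  · rw [if_neg hih, if_neg]
    rintro ⟨hanc, hji⟩
    refine hih ⟨Nat.pos_of_ne_zero ?_, hanc⟩
    rintro rfl
    exact (H.rooted.zero ▸ hji).not_ge (Fin.zero_le _)

open Classical in
/-- The part of the invariant of the burning algorithm on the input `α` that concerns the labels of
the tree edges and the values of `α` at the vertices that burn. -/
structure BurnRecord {n : ℕ} (x α : Fin n → ℕ) (s : BurnState n) (p : ℕ → ℕ) : Prop where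
  label_lt : ∀ k, 0 < k → k ≤ s.counter → s.label s(s.perm (p k), s.perm k) < next x (p k)
  input : ∀ k, 0 < k → k ≤ s.counter → ∀ j : Fin n, s.perm k = j.succ →
    α j + 1 + s.label s(s.perm (p k), s.perm k) +
      ∑ i ∈ Finset.range (k + 1) with Anc p i k ∧ s.perm k < s.perm i, next x (p i) =
    ∑ a ∈ Finset.range k, next x a

namespace BurnRecord

variable {n : ℕ} {x α : Fin n → ℕ} {s : BurnState n} {h : ℕ} {p : ℕ → ℕ} {j : Fin n}

lemma initial (x α : Fin n → ℕ) (p : ℕ → ℕ) : BurnRecord x α (burnInit x α) p where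
  label_lt := fun _ hk0 hk => absurd hk hk0.not_ge
  input := fun _ hk0 hk => absurd hk hk0.not_ge

lemma congr_parent (R : BurnRecord x α s p) (hp : ∀ k, 0 < k → p k < k) {q : ℕ → ℕ}
    (hpq : ∀ k ≤ s.counter, p k = q k) : BurnRecord x α s q where
  label_lt := fun k hk0 hk => hpq k hk ▸ R.label_lt k hk0 hk
  input := fun k hk0 hk j hj => by
    classical
    rw [← hpq k hk, ← R.input k hk0 hk j hj]
    refine congrArg _ (Finset.sum_congr (Finset.filter_congr fun i _ => ?_) fun i hi => ?_)
    · rw [anc_congr hp hpq hk]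
    · have hik := Finset.mem_range_succ_iff.1 (Finset.mem_filter.1 hi).1
      rw [hpq i (hik.trans hk)]

lemma ignite (R : BurnRecord x α s p) (P : BurntPattern x s h p) (C : BurnCounts x α s)
    (H : BurnTree s h p) (hj : j.succ ∉ s.burning)
    (hav : s(s.head, j.succ) ∈ s.edges - s.burnt) (hchips : s.chips j = 0)
    (hpc : p (s.counter + 1) = h) : BurnRecord x α (ignite x s j) p := by
  classical
  have hlabel := C.ignite_label_self H hj hav
  have hold : ∀ k, 0 < k → k ≤ s.counter →
      (VectorParking.ignite x s j).label
        s((VectorParking.ignite x s j).perm (p k), (VectorParking.ignite x s j).perm k) =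
      s.label s(s.perm (p k), s.perm k) := by
    intro k hk0 hk
    have hpk := H.rooted.parent_le hk0 hk
    rw [ignite_perm_of_le hk, ignite_perm_of_le hpk,
      ignite_label_of_mem hj (H.perm_mem hpk) (H.perm_mem hk)]
  refine ⟨fun k hk0 hk => ?_, fun k hk0 hk l hl => ?_⟩
  · obtain hk | rfl := Nat.le_add_one_iff.1 hk
    · exact (hold k hk0 hk).trans_lt (R.label_lt k hk0 hk)
    · rw [ignite_perm_self, hpc, ignite_perm_of_le H.h_le]
      omega
  · obtain hk | rfl := Nat.le_add_one_iff.1 hk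
    · rw [ignite_perm_of_le hk] at hl
      rw [hold k hk0 hk, ← R.input k hk0 hk l hl, ignite_perm_of_le hk]
      refine congrArg _ (Finset.sum_congr (Finset.filter_congr fun i hi => ?_) fun _ _ => rfl)
      rw [ignite_perm_of_le ((Finset.mem_range_succ_iff.1 hi).trans hk)]
    · rw [ignite_perm_self] at hl
      obtain rfl := Fin.succ_injective _ hl
      have hα := C.chips j hj
      have hsum := P.sum_next_eq C H hj
      rw [hchips, zero_add] at hα
      rw [hα] at hsum
      rw [hsum, ignite_perm_self, hpc, ignite_perm_of_le H.h_le, ← hlabel, Nat.add_sub_cancel_left,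
        add_assoc (α j), Finset.range_add_one, Finset.filter_insert,
        if_neg fun h' => h'.2.ne ignite_perm_self.symm]
      refine congrArg _ (Finset.sum_congr (Finset.filter_congr fun i hi => ?_) fun _ _ => rfl)
      have hic := Finset.mem_range_succ_iff.1 hi
      rw [ignite_perm_of_le hic, ← hpc]
      exact and_congr_left' ⟨fun h' => h'.of_ne (by omega), Anc.step (Nat.succ_pos _)⟩

end BurnRecord

/-! ### Termination of the burning algorithm -/

/-- The invariant of the burning algorithm on the input `α`. -/
structure BurnInv {n : ℕ} (x α : Fin n → ℕ) (s : BurnState n) (h : ℕ) (p : ℕ → ℕ) : Prop extends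
  BurnTree s h p, BurnCounts x α s, BurntPattern x s h p, BurnRecord x α s p

namespace BurnInv

variable {n : ℕ} {x α : Fin n → ℕ} {s : BurnState n} {h : ℕ} {p : ℕ → ℕ} {j : Fin n}

lemma initial (x α : Fin n → ℕ) {p : ℕ → ℕ} (hp : ∀ k, 0 < k → p k < k) :
    BurnInv x α (burnInit x α) 0 p :=
  ⟨BurnTree.initial x α hp, BurnCounts.initial x α, BurntPattern.initial x α p,
    BurnRecord.initial x α p⟩

lemma congr_parent (H : BurnInv x α s h p) {q : ℕ → ℕ} (hq : ∀ k, 0 < k → q k < k)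
    (hpq : ∀ k ≤ s.counter, p k = q k) : BurnInv x α s h q :=
  ⟨H.toBurnTree.congr_parent hq hpq, H.toBurnCounts,
    H.toBurntPattern.congr_parent H.toBurnTree hq hpq,
    H.toBurnRecord.congr_parent H.rooted.lt hpq⟩

lemma skip (H : BurnInv x α s h p) (hj : j.succ ∉ s.burning)
    (hav : s(s.head, j.succ) ∉ s.edges - s.burnt) : BurnInv x α (s.skip j) h p := by
  rw [H.mem_edges_sub_burnt_iff H.toBurnTree hj, not_lt] at hav
  exact ⟨{ H.toBurnTree with }, { H.toBurnCounts with },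
    H.toBurntPattern.skip ((H.burnt_le h H.h_le j hj).antisymm hav), { H.toBurnRecord with }⟩

lemma backtrack (H : BurnInv x α s h p) (htodo : s.todo = ∅) (hh : 0 < h) :
    BurnInv x α s.backtrack (p h) p :=
  ⟨H.toBurnTree.backtrack hh, { H.toBurnCounts with },
    H.toBurntPattern.backtrack H.toBurnTree htodo hh, { H.toBurnRecord with }⟩

lemma burnEdge (H : BurnInv x α s h p) (hj : j ∈ s.todo) (hmax : ∀ k ∈ s.todo, k ≤ j)
    (hav : s(s.head, j.succ) ∈ s.edges - s.burnt) (hchips : 1 ≤ s.chips j) :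
    BurnInv x α (s.burnEdge j) h p :=
  ⟨{ H.toBurnTree with }, H.toBurnCounts.burnEdge H.toBurnTree (H.todo j hj) hav hchips,
    H.toBurntPattern.burnEdge H.toBurnTree hj hmax
      ((H.mem_edges_sub_burnt_iff H.toBurnTree (H.todo j hj)).1 hav), { H.toBurnRecord with }⟩

lemma ignite (H : BurnInv x α s h p) (hj : j ∈ s.todo) (hmax : ∀ k ∈ s.todo, k ≤ j)
    (hav : s(s.head, j.succ) ∈ s.edges - s.burnt) (hchips : s.chips j = 0)
    (hpc : p (s.counter + 1) = h) : BurnInv x α (ignite x s j) (s.counter + 1) p := by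
  have hjB := H.todo j hj
  have hlt := (H.mem_edges_sub_burnt_iff H.toBurnTree hjB).1 hav
  exact ⟨H.toBurnTree.ignite hjB hpc fun _ => H.lt_perm_of_parent_eq H.toBurnTree hjB hlt,
    H.toBurnCounts.ignite H.toBurnTree hjB,
    H.toBurntPattern.ignite H.toBurnCounts H.toBurnTree hj hmax hlt hpc,
    H.toBurnRecord.ignite H.toBurntPattern H.toBurnCounts H.toBurnTree hjB hav hchips hpc⟩

lemma exists_step (H : BurnInv x α s h p) :
    (burnStep x s = none ∧ s.todo = ∅ ∧ h = 0) ∨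
    ∃ s' h' p', burnStep x s = some s' ∧ BurnInv x α s' h' p' ∧
      scanMeasure (n - s'.counter) (s'.edges - s'.burnt).card h' s'.todo.card <
        scanMeasure (n - s.counter) (s.edges - s.burnt).card h s.todo.card := by
  obtain hm | ⟨j, hm⟩ := (maxOf (· < ·) s.todo).eq_none_or_eq_some
  · have htodo := maxOf_eq_none.1 hm
    obtain hh | hh := Nat.eq_zero_or_pos h
    · exact Or.inl ⟨burnStep_of_head_eq_zero htodo (H.head_eq_zero_iff.2 hh), htodo, hh⟩
    · exact Or.inr ⟨_, _, p, burnStep_of_head_ne_zero htodo (mt H.head_eq_zero_iff.1 hh.ne'),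
        H.backtrack htodo hh, scanMeasure_lt_of_backtrack (H.rooted.lt h hh)⟩
  right
  have hj := (maxOf_eq_some.1 hm).1
  have hmax : ∀ k ∈ s.todo, k ≤ j := fun _ => le_of_maxOf_eq_some hm
  by_cases hav : s(s.head, j.succ) ∈ s.edges - s.burnt
  · obtain hchips | hchips := Nat.eq_zero_or_pos (s.chips j)
    · have hq : ∀ k, 0 < k → Function.update p (s.counter + 1) h k < k := fun k hk => by
        obtain rfl | hkc := eq_or_ne k (s.counter + 1)
        · rw [Function.update_self]
          exact Nat.lt_add_one_of_le H.h_le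
        · rw [Function.update_of_ne hkc]
          exact H.rooted.lt k hk
      have H' := H.congr_parent hq fun k hk => (Function.update_of_ne (by omega) _ _).symm
      exact ⟨_, _, _, burnStep_of_eq_zero hm hav hchips,
        H'.ignite hj hmax hav hchips (Function.update_self _ _ _),
        scanMeasure_lt_of_ignite (Nat.sub_succ_lt_self _ _ (H.counter_lt (H.todo j hj)))⟩
    · exact ⟨_, h, p, burnStep_of_pos hm hav hchips, H.burnEdge hj hmax hav hchips,
        scanMeasure_lt_of_burn (card_sub_add_singleton_lt hav)⟩
  · exact ⟨_, h, p, burnStep_of_notMem hm hav, H.skip (H.todo j hj) hav,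
      scanMeasure_lt_of_skip (Finset.card_erase_lt_of_mem hj)⟩

end BurnInv

lemma burn_terminates {n : ℕ} (x α : Fin n → ℕ) :
    ∃ s p, StateTransition.Reaches (burnStep x) (burnInit x α) s ∧ burnStep x s = none ∧
      BurnInv x α s 0 p ∧ s.todo = ∅ := by
  obtain ⟨s, ⟨h, p⟩, hreach, hhalt, H⟩ := exists_halting (burnStep x)
    (fun s (g : ℕ × (ℕ → ℕ)) => BurnInv x α s g.1 g.2)
    (fun s g => scanMeasure (n - s.counter) (s.edges - s.burnt).card g.1 s.todo.card)
    (fun s g H => H.exists_step.imp And.left fun ⟨s', h', p', hstep⟩ => ⟨s', (h', p'), hstep⟩)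
    (burnInit x α) (0, fun _ => 0) (BurnInv.initial x α fun _ hk => hk)
  obtain ⟨-, htodo, rfl⟩ | ⟨s', h', p', hstep, -⟩ := H.exists_step
  · exact ⟨s, p, hreach, hhalt, H, htodo⟩
  · exact absurd (hhalt.symm.trans hstep) (Option.some_ne_none s').symm

/-! ### Sorting -/

lemma exists_sorting {V : Type*} [Fintype V] (lt : V → V → Prop) [IsStrictTotalOrder V lt] :
    ∃ e : Fin (Fintype.card V) ≃ V, ∀ i j, i < j → lt (e i) (e j) := by
  classical
  let _ := linearOrderOfSTO lt
  exact ⟨(monoEquivOfFin V rfl).toEquiv, fun i j hij => (monoEquivOfFin V rfl).strictMono hij⟩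

section sortPerm

variable {n : ℕ} {lt : Fin n → Fin n → Prop} [IsStrictTotalOrder (Fin n) lt]

lemma sortPerm_lt_iff {i j : Fin n} : lt (sortPerm lt i) (sortPerm lt j) ↔ i < j := by
  have hex : ∃ σ : Equiv.Perm (Fin n), ∀ i j : Fin n, i < j → lt (σ i) (σ j) := by
    obtain ⟨e, he⟩ := exists_sorting lt
    exact ⟨(finCongr (Fintype.card_fin n).symm).trans e, fun i j hij => he _ _ hij⟩
  have hmono : ∀ i j : Fin n, i < j → lt (sortPerm lt i) (sortPerm lt j) := by
    rw [sortPerm, dif_pos hex]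
    exact hex.choose_spec
  refine ⟨fun hlt => ?_, hmono i j⟩
  obtain hij | rfl | hji := lt_trichotomy i j
  · exact hij
  · exact absurd hlt (irrefl _)
  · exact absurd hlt (asymm (hmono j i hji))

lemma sortPerm_eq {σ : Equiv.Perm (Fin n)} (hσ : ∀ i j, lt (σ i) (σ j) ↔ i < j) :
    sortPerm lt = σ := by
  have hmono : StrictMono ((sortPerm lt).trans σ.symm) := fun i j hij => by
    rw [← hσ]
    simpa only [Equiv.trans_apply, Equiv.apply_symm_apply] using sortPerm_lt_iff.2 hij
  have hrefl : (⟨(sortPerm lt).trans σ.symm, hmono.le_iff_le⟩ : Fin n ≃o Fin n) =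
      OrderIso.refl _ := Subsingleton.elim _ _
  exact Equiv.ext fun i => (Equiv.symm_apply_eq σ).1 (DFunLike.congr_fun hrefl i)

end sortPerm

/-! ### Parking functions -/

lemma sum_range_next {n : ℕ} (x : Fin n → ℕ) (k : Fin n) :
    ∑ a ∈ Finset.range (k.val + 1), next x a = ∑ a ∈ Finset.Iic k, x a := by
  rw [Nat.range_succ_eq_Iic, ← Fin.map_valEmbedding_Iic, Finset.sum_map]
  exact Finset.sum_congr rfl fun a _ => dif_pos a.isLt

lemma sum_sum_Iic {n : ℕ} (x : Fin n → ℤ) :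
    ∑ k : Fin n, ∑ a ∈ Finset.Iic k, x a = ∑ i : Fin n, ((n : ℤ) - (i.val : ℤ)) * x i := by
  rw [Finset.sum_comm' (t' := Finset.univ) (s' := fun a => Finset.Ici a) (by simp)]
  refine Finset.sum_congr rfl fun a _ => ?_
  rw [Finset.sum_const, Fin.card_Ici, nsmul_eq_mul, Nat.cast_sub a.isLt.le]

lemma IsParking.sort_lt {n : ℕ} {x α : Fin n → ℕ} (hα : IsParking x α) {k m : Fin n}
    (hkm : k ≤ m) : α (Tuple.sort α k) < ∑ a ∈ Finset.Iic m, x a := by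
  have hmono : α (Tuple.sort α k) ≤ α (Tuple.sort α m) := Tuple.monotone_sort α hkm
  have hm := hα m
  zify at hmono ⊢
  omega

lemma isParking_of_lt {n : ℕ} {x α : Fin n → ℕ} (τ : Equiv.Perm (Fin n))
    (h : ∀ j, α j < ∑ a ∈ Finset.Iic (τ j), x a) : IsParking x α := by
  intro j
  by_contra hj
  have hj : ∑ a ∈ Finset.Iic j, x a ≤ α (Tuple.sort α j) := by
    zify
    omega
  have hmaps : ∀ k ∈ Finset.Ici j, τ (Tuple.sort α k) ∈ Finset.Ioi j := by
    intro k hk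
    rw [Finset.mem_Ioi]
    by_contra hle
    have hsum : ∑ a ∈ Finset.Iic (τ (Tuple.sort α k)), x a ≤ ∑ a ∈ Finset.Iic j, x a :=
      Finset.sum_le_sum_of_subset (Finset.Iic_subset_Iic.2 (not_lt.1 hle))
    have hmono : α (Tuple.sort α j) ≤ α (Tuple.sort α k) :=
      Tuple.monotone_sort α (Finset.mem_Ici.1 hk)
    exact (h (Tuple.sort α k)).not_ge (hsum.trans (hj.trans hmono))
  have hcard := Finset.card_le_card_of_injOn _ hmaps
    ((τ.injective.comp (Tuple.sort α).injective).injOn)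
  rw [Fin.card_Ici, Fin.card_Ioi] at hcard
  omega

namespace BurnInv

variable {n : ℕ} {x α : Fin n → ℕ} {s : BurnState n} {p : ℕ → ℕ} {j : Fin n}

lemma sum_next_le_of_todo_eq_empty (H : BurnInv x α s 0 p) (htodo : s.todo = ∅)
    (hj : j.succ ∉ s.burning) : ∑ a ∈ Finset.range (s.counter + 1), next x a ≤ α j := by
  have hfull : ∀ a ∈ Finset.range (s.counter + 1), s.burntCount a j = next x a := fun a ha => by
    obtain rfl | ha0 := Nat.eq_zero_or_pos a
    · exact H.todo_full j hj (htodo ▸ Finset.notMem_empty j)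
    · exact H.done_full a (Finset.mem_range_succ_iff.1 ha) (fun hanc => ha0.ne' hanc.eq_zero) j hj
  rw [← Finset.sum_congr rfl hfull, ← H.chips j hj]
  exact Nat.le_add_left _ _

/-- If `c < n` vertices burn at the end, then the `c + 1` smallest values of `α` are small enough
to force their positions to burn. -/
lemma counter_eq_of_isParking (H : BurnInv x α s 0 p) (htodo : s.todo = ∅) (hα : IsParking x α) :
    s.counter = n := by
  refine H.counter_le.eq_of_not_lt fun hc => ?_
  have hburn : ∀ k ∈ Finset.Iic (⟨s.counter, hc⟩ : Fin n),
      ∃ a ∈ Finset.Icc 1 s.counter, s.perm a = (Tuple.sort α k).succ := by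
    intro k hk
    have hmem : (Tuple.sort α k).succ ∈ s.burning := by
      by_contra hnot
      refine (hα.sort_lt (Finset.mem_Iic.1 hk)).not_ge ?_
      rw [← sum_range_next]
      exact H.sum_next_le_of_todo_eq_empty htodo hnot
    obtain ⟨a, ha, hperm⟩ := (H.mem_burning _).1 hmem
    refine ⟨a, Finset.mem_Icc.2 ⟨Nat.pos_of_ne_zero ?_, ha⟩, hperm⟩
    rintro rfl
    exact Fin.succ_ne_zero _ (hperm.symm.trans H.rooted.zero)
  choose! f hf hfperm using hburn
  have hinj : Set.InjOn f (Finset.Iic (⟨s.counter, hc⟩ : Fin n)) := fun k hk l hl hkl =>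
    (Tuple.sort α).injective <| Fin.succ_injective _ <| by
      rw [← hfperm k hk, ← hfperm l hl, hkl]
  have hcard := Finset.card_le_card_of_injOn f hf hinj
  rw [Fin.card_Iic, Nat.card_Icc] at hcard
  exact hcard.not_gt (Nat.lt_succ_self _)

end BurnInv

/-! ### The parking function of a triple -/

namespace Triple

variable {n : ℕ} {t t' : Triple n}

open Classical in
/-- The labelling `ℓ`, extended by `0` to the pairs of vertices that are not edges of the tree. -/
noncomputable def labelAt (t : Triple n) (e : Sym2 (Fin (n + 1))) : ℕ :=
  if h : e ∈ t.tree.edgeSet then t.label ⟨e, h⟩ else 0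

lemma labelAt_of_mem {e : Sym2 (Fin (n + 1))} (h : e ∈ t.tree.edgeSet) :
    t.labelAt e = t.label ⟨e, h⟩ := dif_pos h

lemma ext_labelAt (htree : t.tree = t'.tree)
    (hlabel : ∀ e ∈ t.tree.edgeSet, t.labelAt e = t'.labelAt e)
    (hlt : ∀ i j, t.lt i j ↔ t'.lt i j) : t = t' := by
  obtain ⟨T, l, r⟩ := t
  obtain ⟨T', l', r'⟩ := t'
  obtain rfl : T = T' := htree
  obtain rfl : l = l' := by
    funext ⟨e, he⟩
    have hle := hlabel e he
    rwa [labelAt_of_mem (t := ⟨T, l, r⟩) he, labelAt_of_mem (t := ⟨T, l', r'⟩) he] at hle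
  obtain rfl : r = r' := by
    funext i j
    exact propext (hlt i j)
  rfl

end Triple

open Classical in
/-- The part of the sum `κ(G_x, T, ≺)` that belongs to the pairs with second component `k`. -/
noncomputable def kappaAt {n : ℕ} (x : Fin n → ℕ) (t : Triple n) (k : Fin n) : ℕ :=
  ∑ i : Fin n, if TreeLE t.tree i.succ k.succ ∧ t.lt k i then
    (Gx x).weight s(par t.tree i.succ, k.succ) else 0

/-- The parking function `α` corresponds to the triple `t`. At the vertex with number `k` in the
order `≺`, its value is `x_1 + ⋯ + x_k`, diminished by `1`, by the label of the edge to the parent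
and by the contribution of `k` to `κ`. -/
def Encodes {n : ℕ} (x α : Fin n → ℕ) (t : Triple n) : Prop :=
  ∀ j : Fin n, α j + 1 + t.labelAt s(par t.tree (sortPerm t.lt j).succ, (sortPerm t.lt j).succ) +
    kappaAt x t (sortPerm t.lt j) = ∑ a ∈ Finset.Iic (sortPerm t.lt j), x a

lemma IsRooted.par_succ {n : ℕ} {T : SimpleGraph (Fin (n + 1))} {p : ℕ → ℕ}
    (h : IsRooted T n (vert n) p) (j : Fin n) : par T j.succ = vert n (p (j.val + 1)) := by
  rw [← vert_succ, h.par_eq (Nat.succ_pos _) j.isLt]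

section

variable {n : ℕ} {x α β : Fin n → ℕ} {t : Triple n} {p : ℕ → ℕ}

open Classical in
lemma kappaAt_eq (h : IsRooted t.tree n (vert n) p) (k : Fin n) :
    kappaAt x t k = ∑ i : Fin n with Anc p (i.val + 1) (k.val + 1) ∧ t.lt k i,
      next x (p (i.val + 1)) := by
  rw [kappaAt, Finset.sum_filter]
  refine Finset.sum_congr rfl fun i _ => ?_
  have htree : TreeLE t.tree i.succ k.succ ↔ Anc p (i.val + 1) (k.val + 1) := by
    rw [← vert_succ, ← vert_succ, h.treeLE_iff i.isLt k.isLt]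
  rw [htree]
  split_ifs with hik
  · rw [h.par_succ, ← vert_succ k]
    exact Gx_weight x ((h.lt _ (Nat.succ_pos _)).trans_le (hik.1.le h.lt)) k.isLt
  · rfl

lemma kappa_eq_sum_kappaAt : kappa (Gx x) t.tree t.lt = ∑ k : Fin n, kappaAt x t k :=
  Finset.sum_comm

lemma labelSum_eq_sum_labelAt (h : IsRooted t.tree n (vert n) p) :
    t.labelSum = ∑ k : Fin n, t.labelAt s(par t.tree k.succ, k.succ) := by
  classical
  rw [Triple.labelSum, ← h.parentEdge_bijective.sum_comp]
  refine Finset.sum_congr rfl fun k _ => ?_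
  rw [← Triple.labelAt_of_mem (h.parentEdge_mem k), h.par_succ, parentEdge]

namespace Encodes

lemma unique (hα : Encodes x α t) (hβ : Encodes x β t) : α = β :=
  funext fun j => by linarith only [hα j, hβ j]

lemma isParking (hα : Encodes x α t) : IsParking x α :=
  isParking_of_lt (sortPerm t.lt) fun j => by linarith only [hα j]

lemma rsum_eq (hα : Encodes x α t) (h : IsRooted t.tree n (vert n) p) :
    rsum x α = (kappa (Gx x) t.tree t.lt : ℤ) + (t.labelSum : ℤ) := by
  have hsum : ∑ j : Fin n, (((α j : ℤ) + 1 +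
      t.labelAt s(par t.tree (sortPerm t.lt j).succ, (sortPerm t.lt j).succ)) +
      kappaAt x t (sortPerm t.lt j)) = ∑ j : Fin n, ∑ a ∈ Finset.Iic (sortPerm t.lt j), (x a : ℤ) :=
    Finset.sum_congr rfl fun j _ => by exact_mod_cast hα j
  simp only [Finset.sum_add_distrib] at hsum
  rw [Equiv.sum_comp (sortPerm t.lt) fun k => ∑ a ∈ Finset.Iic k, (x a : ℤ),
    Equiv.sum_comp (sortPerm t.lt) fun k => (kappaAt x t k : ℤ),
    Equiv.sum_comp (sortPerm t.lt) fun k => (t.labelAt s(par t.tree k.succ, k.succ) : ℤ),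
    sum_sum_Iic, Finset.sum_const, Finset.card_univ, Fintype.card_fin, nsmul_eq_mul,
    mul_one] at hsum
  rw [kappa_eq_sum_kappaAt, labelSum_eq_sum_labelAt h, rsum, ← hsum]
  push_cast
  ring

end Encodes

end

/-! ### The output of the burning algorithm -/

namespace BurnInv

variable {n : ℕ} {x α : Fin n → ℕ} {s : BurnState n} {h : ℕ} {p : ℕ → ℕ}

lemma exists_perm (H : BurnInv x α s h p) (hc : s.counter = n) :
    ∃ g : Equiv.Perm (Fin n), ∀ i : Fin n, s.perm (i.val + 1) = (g i).succ := by
  have hne : ∀ i : Fin n, s.perm (i.val + 1) ≠ 0 := fun i hi =>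
    Nat.succ_ne_zero _ (H.rooted.inj _ (by omega) 0 (Nat.zero_le _) (hi.trans H.rooted.zero.symm))
  refine ⟨Equiv.ofBijective (fun i => (s.perm (i.val + 1)).pred (hne i))
    (Finite.injective_iff_bijective.1 fun i j hij => ?_), fun i => ?_⟩
  · have hval := H.rooted.inj _ (by omega) _ (by omega) (Fin.pred_inj.1 hij)
    exact Fin.ext (Nat.succ_injective hval)
  · rw [Equiv.ofBijective_apply, Fin.succ_pred]

lemma output_lt_iff (hc : s.counter = n) (i j : Fin n) :
    (burnOutput s).lt i j ↔ s.perm (i.val + 1) < s.perm (j.val + 1) :=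
  ⟨fun hlt => hlt.2.2, fun hlt => ⟨i.isLt.trans_eq hc.symm, j.isLt.trans_eq hc.symm, hlt⟩⟩

lemma output_lt_iff_of_perm (hc : s.counter = n) {g : Equiv.Perm (Fin n)}
    (hg : ∀ i : Fin n, s.perm (i.val + 1) = (g i).succ) (i j : Fin n) :
    (burnOutput s).lt i j ↔ g i < g j := by
  rw [output_lt_iff hc, hg, hg, Fin.succ_lt_succ_iff]

lemma output_isStrictTotalOrder (H : BurnInv x α s h p) (hc : s.counter = n) :
    IsStrictTotalOrder (Fin n) (burnOutput s).lt :=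
  have ⟨g, hg⟩ := H.exists_perm hc
  RelEmbedding.isStrictTotalOrder (s := (· < ·))
    ⟨g.toEmbedding, fun {i j} => (output_lt_iff_of_perm hc hg i j).symm⟩

lemma sortPerm_output (H : BurnInv x α s h p) (hc : s.counter = n) {g : Equiv.Perm (Fin n)}
    (hg : ∀ i : Fin n, s.perm (i.val + 1) = (g i).succ) :
    sortPerm (burnOutput s).lt = g.symm := by
  have := H.output_isStrictTotalOrder hc
  refine sortPerm_eq fun i j => ?_
  rw [output_lt_iff_of_perm hc hg, Equiv.apply_symm_apply, Equiv.apply_symm_apply]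

lemma rooted_output (H : BurnInv x α s h p) (hc : s.counter = n) :
    IsRooted (burnOutput s).tree n (vert n) p := by
  have hle : ∀ u : Fin (n + 1), u.val ≤ s.counter := fun u => by omega
  have hperm : ∀ a ≤ n, ∀ u : Fin (n + 1), s.perm u.val = s.perm a ↔ u = vert n a := by
    intro a ha u
    constructor
    · intro hua
      rw [← H.rooted.inj u.val (hle u) a (ha.trans_eq hc.symm) hua, vert_val]
    · rintro rfl
      rw [val_vert ha]
  have hadj : ∀ u v, (burnOutput s).tree.Adj u v ↔ s.tree.Adj (s.perm u.val) (s.perm v.val) :=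
    fun u v => ⟨fun huv => huv.2.2, fun huv => ⟨hle u, hle v, huv⟩⟩
  refine ⟨vert_zero n, fun a ha b hb => vert_inj ha hb, H.rooted.lt, fun u v => ?_⟩
  rw [hadj, H.rooted.adj, hc]
  refine exists_congr fun k => and_congr_right fun hk0 => and_congr_right fun hk => ?_
  have hpk := (H.rooted.lt k hk0).le.trans hk
  rw [hperm k hk, hperm k hk, hperm _ hpk, hperm _ hpk]

lemma labelAt_output (H : BurnInv x α s h p) (hc : s.counter = n) {k : ℕ} (hk0 : 0 < k)
    (hk : k ≤ n) : (burnOutput s).labelAt s(vert n (p k), vert n k) =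
      s.label s(s.perm (p k), s.perm k) := by
  have hpk := (H.rooted.lt k hk0).le.trans hk
  have hmem : s(vert n (p k), vert n k) ∈ (burnOutput s).tree.edgeSet :=
    ((H.rooted_output hc).adj_parent hk0 hk).symm
  rw [Triple.labelAt_of_mem hmem]
  change s.label (Sym2.map (fun a : Fin (n + 1) => s.perm a.val) s(vert n (p k), vert n k)) = _
  rw [Sym2.map_mk, val_vert hpk, val_vert hk]

open Classical in
lemma kappaAt_output (H : BurnInv x α s h p) (hc : s.counter = n) (k : Fin n) :
    kappaAt x (burnOutput s) k = ∑ i ∈ Finset.range (k.val + 2)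
      with Anc p i (k.val + 1) ∧ s.perm (k.val + 1) < s.perm i, next x (p i) := by
  have hroot := H.rooted_output hc
  have hsub : Finset.range (k.val + 2) ⊆ Finset.range (n + 1) :=
    Finset.range_subset_range.2 (Nat.succ_le_succ k.isLt)
  rw [kappaAt_eq hroot, Finset.sum_filter, Finset.sum_filter, Finset.sum_subset hsub,
    Finset.sum_range_succ', Finset.sum_range, if_neg, add_zero]
  · exact Finset.sum_congr rfl fun i _ => if_congr (and_congr_right' (output_lt_iff hc k i)) rfl rfl
  · rw [H.rooted.zero]
    exact fun h0 => h0.2.not_ge (Fin.zero_le _)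
  · exact fun i _ hi => if_neg fun hik =>
      hi (Finset.mem_range.2 (Nat.lt_add_one_of_le (hik.1.le hroot.lt)))

lemma output_mem_triples (H : BurnInv x α s h p) (hc : s.counter = n) :
    burnOutput s ∈ Triples x := by
  have hroot := H.rooted_output hc
  have hple : ∀ k < n, p (k + 1) ≤ n := fun k hk => (hroot.lt _ (Nat.succ_pos k)).le.trans hk
  refine ⟨hroot.isRootedPlaneTree (hc ▸ H.preorder),
    ⟨H.output_isStrictTotalOrder hc, fun i j hij hpar => ?_⟩, fun e => ?_⟩
  · rw [hroot.par_succ, hroot.par_succ] at hpar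
    exact (output_lt_iff hc j i).2 <| H.order _ _ (Nat.succ_pos _) (Nat.succ_lt_succ hij)
      (j.isLt.trans_eq hc.symm) (vert_inj (hple i i.isLt) (hple j j.isLt) hpar)
  · obtain ⟨j, rfl⟩ := hroot.parentEdge_bijective.2 e
    have hlt := hroot.lt (j.val + 1) (Nat.succ_pos _)
    dsimp only
    rw [← Triple.labelAt_of_mem, parentEdge, ← vert_succ,
      H.labelAt_output hc (Nat.succ_pos _) j.isLt, Gx_weight x hlt j.isLt]
    exact H.label_lt _ (Nat.succ_pos _) (j.isLt.trans_eq hc.symm)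

lemma encodes_output (H : BurnInv x α s h p) (hc : s.counter = n) :
    Encodes x α (burnOutput s) := by
  obtain ⟨g, hg⟩ := H.exists_perm hc
  intro j
  rw [H.sortPerm_output hc hg]
  obtain ⟨k, rfl⟩ := g.surjective j
  rw [Equiv.symm_apply_apply, ← sum_range_next, (H.rooted_output hc).par_succ, ← vert_succ,
    H.labelAt_output hc (Nat.succ_pos _) k.isLt, H.kappaAt_output hc]
  exact H.input (k.val + 1) (Nat.succ_pos _) (k.isLt.trans_eq hc.symm) (g k) (hg k)

end BurnInv

/-! ### Moves of the inverse algorithm -/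

namespace UnburnState

variable {n : ℕ}

/-- The move after a vertex `j` without unburnt edges to the head has been found: the scan goes on
with the next vertex. -/
def skip (u : UnburnState n) (j : Fin n) : UnburnState n := { u with todo := u.todo.erase j }

/-- The move after a completed scan at a head other than the root: the parent of the head becomes
the head. -/
noncomputable def backtrack (t : Triple n) (u : UnburnState n) : UnburnState n :=
  { u with head := par t.tree u.head, todo := notBurning u.burning }

/-- The move that burns a copy of the edge `{head, j}` and places a chip on `j`. -/
def burnEdge (u : UnburnState n) (j : Fin n) : UnburnState n :=
  { u with
    burnt := u.burnt + {s(u.head, j.succ)}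
    chips := Function.update u.chips j (u.chips j + 1) }

lemma burnEdge_chips (u : UnburnState n) (j : Fin n) :
    (u.burnEdge j).chips = Function.update u.chips j (u.chips j + 1) := rfl

/-- The move on which `j` starts to burn. -/
def ignite (u : UnburnState n) (j : Fin n) : UnburnState n :=
  { u with
    burning := insert j.succ u.burning
    head := j.succ
    todo := notBurning (insert j.succ u.burning) }

/-- The condition under which the inverse algorithm, having found an unburnt edge `{head, j}`, sets
fire to `j`. -/
def Ignites (G : Multigraph (Fin (n + 1))) (t : Triple n) (u : UnburnState n) (j : Fin n) : Prop :=
  ∃ h : s(u.head, j.succ) ∈ t.tree.edgeSet, t.label ⟨s(u.head, j.succ), h⟩ =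
    (G.edges - (u.burnt + {s(u.head, j.succ)})).count s(u.head, j.succ)

/-- Between the states `u` and `v` of the inverse algorithm, fire and chips have only been added,
and no chips on vertices that burn in `u`. -/
structure Extends (u v : UnburnState n) : Prop where
  burning_subset : u.burning ⊆ v.burning
  chips_le : ∀ j, u.chips j ≤ v.chips j
  chips_eq : ∀ j : Fin n, j.succ ∈ u.burning → v.chips j = u.chips j

namespace Extends

variable {u v w : UnburnState n} {j : Fin n}

lemma of_eq (hburning : v.burning = u.burning) (hchips : v.chips = u.chips) : Extends u v :=
  ⟨hburning.ge, fun j => (congrFun hchips j).ge, fun j _ => congrFun hchips j⟩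

lemma trans (huv : Extends u v) (hvw : Extends v w) : Extends u w where
  burning_subset := huv.burning_subset.trans hvw.burning_subset
  chips_le := fun j => (huv.chips_le j).trans (hvw.chips_le j)
  chips_eq := fun j hj => (hvw.chips_eq j (huv.burning_subset hj)).trans (huv.chips_eq j hj)

lemma burnEdge (hj : j.succ ∉ u.burning) : Extends u (u.burnEdge j) where
  burning_subset := subset_rfl
  chips_le := le_update_self_iff.2 (Nat.le_succ _)
  chips_eq := fun _ hk =>
    Function.update_of_ne (ne_of_apply_ne Fin.succ (ne_of_mem_of_not_mem hk hj)) _ _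

lemma ignite : Extends u (u.ignite j) where
  burning_subset := Finset.subset_insert _ _
  chips_le := fun _ => le_rfl
  chips_eq := fun _ _ => rfl

end Extends

end UnburnState

section unburnStep

variable {n : ℕ} {G : Multigraph (Fin (n + 1))} {t : Triple n} {u : UnburnState n} {j : Fin n}

lemma unburnStep_of_head_eq_zero [IsStrictTotalOrder (Fin n) t.lt] (htodo : u.todo = ∅)
    (hhead : u.head = 0) : unburnStep G t u = none := by
  simp only [unburnStep, maxOf_eq_none.2 htodo, hhead, ne_eq, not_true_eq_false, if_false]

lemma unburnStep_of_head_ne_zero [IsStrictTotalOrder (Fin n) t.lt] (htodo : u.todo = ∅)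
    (hhead : u.head ≠ 0) : unburnStep G t u = some (u.backtrack t) := by
  simp only [unburnStep, maxOf_eq_none.2 htodo, if_pos hhead, UnburnState.backtrack]

lemma unburnStep_of_notMem (hj : maxOf t.lt u.todo = some j)
    (hav : s(u.head, j.succ) ∉ G.edges - u.burnt) : unburnStep G t u = some (u.skip j) := by
  simp only [unburnStep, hj, if_neg hav, UnburnState.skip]

lemma unburnStep_of_ignites (hj : maxOf t.lt u.todo = some j)
    (hav : s(u.head, j.succ) ∈ G.edges - u.burnt) (hign : u.Ignites G t j) :
    unburnStep G t u = some (u.ignite j) := by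
  rw [UnburnState.Ignites] at hign
  simp only [unburnStep, hj, if_pos hav, if_pos hign, UnburnState.ignite]

lemma unburnStep_of_not_ignites (hj : maxOf t.lt u.todo = some j)
    (hav : s(u.head, j.succ) ∈ G.edges - u.burnt) (hign : ¬ u.Ignites G t j) :
    unburnStep G t u = some (u.burnEdge j) := by
  rw [UnburnState.Ignites] at hign
  simp only [unburnStep, hj, if_pos hav, if_neg hign, UnburnState.burnEdge]

end unburnStep

/-! ### The invariant of the inverse algorithm -/

/-- The membership of `t` in `Triples x`, in terms of the parent function `p` of the tree. -/
structure IsTriple {n : ℕ} (x : Fin n → ℕ) (t : Triple n) (p : ℕ → ℕ) : Prop where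
  rooted : IsRooted t.tree n (vert n) p
  preorder : IsPreorder n p
  total : IsStrictTotalOrder (Fin n) t.lt
  sibling : ∀ i j : Fin n, i < j → p (i.val + 1) = p (j.val + 1) → t.lt j i
  label_lt : ∀ j : Fin n, t.labelAt (parentEdge n p j) < next x (p (j.val + 1))

lemma exists_isTriple {n : ℕ} {x : Fin n → ℕ} {t : Triple n} (ht : t ∈ Triples x) :
    ∃ p, IsTriple x t p := by
  obtain ⟨htree, horder, hlabel⟩ := ht
  obtain ⟨p, hroot, hpre⟩ := htree.exists_isRooted
  refine ⟨p, hroot, hpre, horder.1, fun i j hij hp => horder.2 i j hij ?_, fun j => ?_⟩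
  · rw [hroot.par_succ, hroot.par_succ, hp]
  · rw [Triple.labelAt_of_mem (hroot.parentEdge_mem j),
      ← Gx_weight x (hroot.lt _ (Nat.succ_pos _)) j.isLt, vert_succ]
    exact hlabel _

/-- The invariant of the inverse algorithm: the vertices `0, …, c` burn. -/
structure UnburnInv {n : ℕ} (x : Fin n → ℕ) (t : Triple n) (p : ℕ → ℕ) (u : UnburnState n)
    (c : ℕ) : Prop where
  le : c ≤ n
  mem_burning : ∀ v, v ∈ u.burning ↔ v.val ≤ c
  head_le : u.head.val ≤ c
  todo : ∀ j ∈ u.todo, c ≤ j.val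
  burnt_zero : ∀ v w, v ∉ u.burning → w ∉ u.burning → u.burnt.count s(v, w) = 0
  pending : ∀ j : Fin n, c ≤ j.val → p (j.val + 1) ≤ c → Anc p (p (j.val + 1)) u.head.val
  children : ∀ j : Fin n, c ≤ j.val → p (j.val + 1) = u.head.val → j ∈ u.todo
  room : ∀ j : Fin n, c ≤ j.val →
    u.burnt.count (parentEdge n p j) + 1 + t.labelAt (parentEdge n p j) ≤ next x (p (j.val + 1))

lemma parentEdge_of_eq {n : ℕ} {p : ℕ → ℕ} {j : Fin n} {v : Fin (n + 1)}
    (h : p (j.val + 1) = v.val) : parentEdge n p j = s(v, j.succ) := by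
  rw [parentEdge, h, vert_val]

namespace UnburnInv

variable {n : ℕ} {x : Fin n → ℕ} {t : Triple n} {p : ℕ → ℕ} {u : UnburnState n} {c : ℕ} {j : Fin n}

lemma initial (ht : IsTriple x t p) : UnburnInv x t p (unburnInit n) 0 where
  le := Nat.zero_le _
  mem_burning := fun v => by
    rw [unburnInit, Finset.mem_singleton, Nat.le_zero, Fin.ext_iff, Fin.val_zero]
  head_le := le_rfl
  todo := fun _ _ => Nat.zero_le _
  burnt_zero := fun _ _ _ _ => Multiset.count_zero _
  pending := fun j _ hp => by
    rw [Nat.le_zero.1 hp]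
    exact anc_root ht.rooted.lt _
  children := fun j _ _ =>
    mem_notBurning.2 fun hj => Fin.succ_ne_zero j (Finset.mem_singleton.1 hj)
  room := fun j _ => by
    have := ht.label_lt j
    rw [unburnInit, Multiset.count_zero]
    omega

lemma succ_notMem (H : UnburnInv x t p u c) : j.succ ∉ u.burning ↔ c ≤ j.val := by
  rw [H.mem_burning, Fin.val_succ, Nat.succ_le_iff, not_lt]

lemma mem_notBurning_iff (H : UnburnInv x t p u c) : j ∈ notBurning u.burning ↔ c ≤ j.val := by
  rw [mem_notBurning, H.succ_notMem]

lemma weight_eq (H : UnburnInv x t p u c) (hj : c ≤ j.val) :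
    (Gx x).weight s(u.head, j.succ) = next x u.head.val := by
  rw [← vert_val u.head, ← vert_succ,
    Gx_weight x (Nat.lt_add_one_of_le (H.head_le.trans hj)) j.isLt, vert_val]

lemma mem_edges_sub_burnt_iff (H : UnburnInv x t p u c) (hj : c ≤ j.val) :
    s(u.head, j.succ) ∈ (Gx x).edges - u.burnt ↔
      u.burnt.count s(u.head, j.succ) < next x u.head.val := by
  rw [mem_sub_iff_count_lt, count_edges, H.weight_eq hj]

lemma ignites_iff (H : UnburnInv x t p u c) (ht : IsTriple x t p) (hj : c ≤ j.val)
    (hav : s(u.head, j.succ) ∈ (Gx x).edges - u.burnt) :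
    u.Ignites (Gx x) t j ↔ p (j.val + 1) = u.head.val ∧
      u.burnt.count s(u.head, j.succ) + (1 + t.labelAt s(u.head, j.succ)) = next x u.head.val := by
  have hadj : s(u.head, j.succ) ∈ t.tree.edgeSet ↔ p (j.val + 1) = u.head.val := by
    rw [SimpleGraph.mem_edgeSet, ← vert_val u.head, ← vert_succ,
      ht.rooted.adj_iff (Nat.lt_add_one_of_le (H.head_le.trans hj)) j.isLt, vert_val]
  rw [H.mem_edges_sub_burnt_iff hj] at hav
  rw [UnburnState.Ignites, Multiset.count_sub, count_edges, H.weight_eq hj, Multiset.count_add,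
    Multiset.count_singleton_self, ← hadj, ← exists_prop]
  refine exists_congr fun h => ?_
  rw [Triple.labelAt_of_mem h]
  omega

lemma mem_edges_of_child (H : UnburnInv x t p u c) (hj : c ≤ j.val)
    (hp : p (j.val + 1) = u.head.val) : s(u.head, j.succ) ∈ (Gx x).edges - u.burnt := by
  have hroom := H.room j hj
  rw [parentEdge_of_eq hp, hp] at hroom
  rw [H.mem_edges_sub_burnt_iff hj]
  omega

lemma anc_parent_next (H : UnburnInv x t p u c) (ht : IsTriple x t p) (hc : c < n) :
    Anc p (p (c + 1)) u.head.val :=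
  H.pending ⟨c, hc⟩ le_rfl (Nat.lt_add_one_iff.1 (ht.rooted.lt _ (Nat.succ_pos c)))

lemma eq_of_head_eq_zero (H : UnburnInv x t p u c) (ht : IsTriple x t p) (htodo : u.todo = ∅)
    (hhead : u.head = 0) : c = n := by
  by_contra hne
  have hcn := lt_of_le_of_ne H.le hne
  have hanc := H.anc_parent_next ht hcn
  rw [hhead] at hanc
  have hmem := H.children ⟨c, hcn⟩ le_rfl (by rw [hhead]; exact hanc.eq_zero)
  exact Finset.notMem_empty _ (htodo ▸ hmem)

lemma skip (H : UnburnInv x t p u c) (hav : s(u.head, j.succ) ∉ (Gx x).edges - u.burnt) :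
    UnburnInv x t p (u.skip j) c :=
  { H with
    todo := fun k hk => H.todo k (Finset.mem_of_mem_erase hk)
    children := fun k hk hp => Finset.mem_erase.2
      ⟨fun hkj => hav (hkj ▸ H.mem_edges_of_child hk hp), H.children k hk hp⟩ }

lemma backtrack_head_val (H : UnburnInv x t p u c) (ht : IsTriple x t p) (hhead : u.head ≠ 0) :
    (u.backtrack t).head.val = p u.head.val := by
  have hpos : 0 < u.head.val := Fin.pos_of_ne_zero hhead
  have hle := H.head_le.trans H.le
  have hpar := ht.rooted.par_eq hpos hle
  rw [vert_val] at hpar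
  rw [UnburnState.backtrack, hpar, val_vert (ht.rooted.parent_le hpos hle)]

lemma backtrack (H : UnburnInv x t p u c) (ht : IsTriple x t p) (htodo : u.todo = ∅)
    (hhead : u.head ≠ 0) : UnburnInv x t p (u.backtrack t) c := by
  have hpar := H.backtrack_head_val ht hhead
  refine { H with head_le := ?_, todo := ?_, pending := ?_, children := ?_ }
  · rw [hpar]
    exact (ht.rooted.lt _ (Fin.pos_of_ne_zero hhead)).le.trans H.head_le
  · exact fun j hj => H.mem_notBurning_iff.1 hj
  · intro j hj hp
    rw [hpar]
    exact (H.pending j hj hp).of_ne fun h => Finset.notMem_empty _ (htodo ▸ H.children j hj h)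
  · exact fun j hj _ => H.mem_notBurning_iff.2 hj

lemma burnEdge (H : UnburnInv x t p u c) (ht : IsTriple x t p) (hj : c ≤ j.val)
    (hav : s(u.head, j.succ) ∈ (Gx x).edges - u.burnt) (hign : ¬ u.Ignites (Gx x) t j) :
    UnburnInv x t p (u.burnEdge j) c := by
  have hheadB : u.head ∈ u.burning := (H.mem_burning _).2 H.head_le
  refine { H with burnt_zero := fun v w hv hw => ?_, room := fun k hk => ?_ }
  · rw [UnburnState.burnEdge, Multiset.count_add, H.burnt_zero v w hv hw, Multiset.count_singleton,
      if_neg (mk_ne_mk_of_notMem hheadB hv hw)]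
  · have hroom := H.room k hk
    rw [UnburnState.burnEdge, Multiset.count_add, Multiset.count_singleton]
    split_ifs with hedge
    · obtain ⟨hhead, hkj⟩ := (mk_eq_mk_iff_of_mem hheadB (H.succ_notMem.2 hk)).1 hedge.symm
      obtain rfl := Fin.succ_injective _ hkj
      have hp : p (j.val + 1) = u.head.val := by
        rw [hhead, val_vert (ht.rooted.parent_le (Nat.succ_pos _) j.isLt)]
      rw [H.ignites_iff ht hj hav, not_and] at hign
      have hne := hign hp
      rw [parentEdge_of_eq hp, hp] at hroom ⊢
      omega
    · exact hroom

lemma parent_next_eq_head (H : UnburnInv x t p u c) (ht : IsTriple x t p) (hj : c < j.val)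
    (hp : p (j.val + 1) = u.head.val) : p (c + 1) = u.head.val := by
  by_contra hne
  obtain ⟨i, i0, hi, hpi⟩ := (H.anc_parent_next ht (hj.trans j.isLt)).exists_child hne
  have hic : i ≤ c := (hi.le ht.rooted.lt).trans H.head_le
  have hij : Anc p i (j.val + 1) := Anc.step (Nat.succ_pos _) (hp ▸ hi)
  have hanc := ht.preorder i (c + 1) (j.val + 1) i0 (by omega) (by omega) j.isLt hij
  have hle := hanc.le_parent ht.rooted.lt (by omega)
  exact (ht.rooted.lt i i0).not_ge (hpi ▸ hle)

lemma val_eq_of_parent_eq_head (H : UnburnInv x t p u c) (ht : IsTriple x t p) (hj : j ∈ u.todo)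
    (hmax : ∀ k ∈ u.todo, k ≠ j → t.lt k j) (hp : p (j.val + 1) = u.head.val) : j.val = c := by
  have := ht.total
  have hcj := H.todo j hj
  by_contra hne
  have hlt : c < j.val := lt_of_le_of_ne hcj (Ne.symm hne)
  have hnext := H.parent_next_eq_head ht hlt hp
  have hmem := H.children ⟨c, hlt.trans j.isLt⟩ le_rfl hnext
  exact asymm (hmax _ hmem fun h => hlt.ne (congrArg Fin.val h))
    (ht.sibling ⟨c, hlt.trans j.isLt⟩ j hlt (hnext.trans hp.symm))

lemma ignite (H : UnburnInv x t p u c) (hj : j.val = c) (hp : p (j.val + 1) = u.head.val) :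
    UnburnInv x t p (u.ignite j) (c + 1) := by
  subst hj
  have hmem : ∀ v, v ∈ (u.ignite j).burning ↔ v.val ≤ j.val + 1 := fun v => by
    rw [UnburnState.ignite, Finset.mem_insert, H.mem_burning, Fin.ext_iff, Fin.val_succ]
    omega
  have hnot : ∀ k, k ∈ (u.ignite j).todo ↔ j.val + 1 ≤ k.val := fun k => by
    rw [← not_lt, ← Nat.succ_le_iff, Nat.succ_eq_add_one, ← Fin.val_succ k, ← hmem]
    exact mem_notBurning
  refine
    { le := j.isLt
      mem_burning := hmem
      head_le := le_rfl
      todo := fun k => (hnot k).1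
      burnt_zero := fun v w hv hw => H.burnt_zero v w
        (mt Finset.mem_insert_of_mem hv) (mt Finset.mem_insert_of_mem hw)
      pending := fun k hk hpk => ?_
      children := fun k hk _ => (hnot k).2 hk
      room := fun k hk => H.room k (by omega) }
  change Anc p (p (k.val + 1)) (j.val + 1)
  obtain hpk | hpk := Nat.le_add_one_iff.1 hpk
  · exact Anc.step (Nat.succ_pos _) (hp ▸ H.pending k (by omega) hpk)
  · exact hpk ▸ Anc.refl

lemma exists_step (H : UnburnInv x t p u c) (ht : IsTriple x t p) :
    unburnStep (Gx x) t u = none ∨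
    ∃ u' c', unburnStep (Gx x) t u = some u' ∧ UnburnInv x t p u' c' ∧ u.Extends u' ∧
      scanMeasure (n - c') ((Gx x).edges - u'.burnt).card u'.head.val u'.todo.card <
        scanMeasure (n - c) ((Gx x).edges - u.burnt).card u.head.val u.todo.card := by
  have := ht.total
  obtain hm | ⟨j, hm⟩ := (maxOf t.lt u.todo).eq_none_or_eq_some
  · have htodo := maxOf_eq_none.1 hm
    by_cases hhead : u.head = 0
    · exact Or.inl (unburnStep_of_head_eq_zero htodo hhead)
    · refine Or.inr ⟨_, c, unburnStep_of_head_ne_zero htodo hhead, H.backtrack ht htodo hhead,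
        .of_eq rfl rfl, scanMeasure_lt_of_backtrack ?_⟩
      rw [H.backtrack_head_val ht hhead]
      exact ht.rooted.lt _ (Fin.pos_of_ne_zero hhead)
  right
  obtain ⟨hj, hmax⟩ := maxOf_eq_some.1 hm
  have hcj := H.todo j hj
  by_cases hav : s(u.head, j.succ) ∈ (Gx x).edges - u.burnt
  · by_cases hign : u.Ignites (Gx x) t j
    · have hp := ((H.ignites_iff ht hcj hav).1 hign).1
      exact ⟨_, _, unburnStep_of_ignites hm hav hign,
        H.ignite (H.val_eq_of_parent_eq_head ht hj hmax hp) hp, .ignite,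
        scanMeasure_lt_of_ignite (Nat.sub_succ_lt_self _ _ (hcj.trans_lt j.isLt))⟩
    · exact ⟨_, c, unburnStep_of_not_ignites hm hav hign, H.burnEdge ht hcj hav hign,
        .burnEdge (H.succ_notMem.2 hcj), scanMeasure_lt_of_burn (card_sub_add_singleton_lt hav)⟩
  · exact ⟨_, c, unburnStep_of_notMem hm hav, H.skip hav, .of_eq rfl rfl,
      scanMeasure_lt_of_skip (Finset.card_erase_lt_of_mem hj)⟩

lemma extends_of_reaches (H : UnburnInv x t p u c) (ht : IsTriple x t p) {v : UnburnState n}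
    (huv : StateTransition.Reaches (unburnStep (Gx x) t) u v) : u.Extends v := by
  induction huv using Relation.ReflTransGen.head_induction_on generalizing c with
  | refl => exact .of_eq rfl rfl
  | @head u w huw _ ih =>
    obtain hnone | ⟨u', c', hsome, H', hext, -⟩ := H.exists_step ht
    · exact absurd (hnone.symm.trans huw) (Option.some_ne_none w).symm
    · obtain rfl := Option.some.inj (hsome.symm.trans huw)
      exact hext.trans (ih H')

end UnburnInv

lemma unburn_terminates {n : ℕ} {x : Fin n → ℕ} {t : Triple n} {p : ℕ → ℕ} (ht : IsTriple x t p) :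
    ∃ u, StateTransition.Reaches (unburnStep (Gx x) t) (unburnInit n) u ∧
      unburnStep (Gx x) t u = none := by
  obtain ⟨u, _, hreach, hhalt, -⟩ := exists_halting (unburnStep (Gx x) t)
    (fun u c => UnburnInv x t p u c)
    (fun u c => scanMeasure (n - c) ((Gx x).edges - u.burnt).card u.head.val u.todo.card)
    (fun u c H => (H.exists_step ht).imp_right
      fun ⟨u', c', hstep, H', _, hlt⟩ => ⟨u', c', hstep, H', hlt⟩)
    (unburnInit n) 0 (UnburnInv.initial ht)
  exact ⟨u, hreach, hhalt⟩

/-! ### The two algorithms in lockstep -/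

/-- The state `s` of the burning algorithm on the input `α` corresponds to the state `u` of the
inverse algorithm on the input `t`; the vertex `j` of the former is the vertex `τ j` of the latter,
and `p` is the parent function of the tree of `t`. -/
structure Mirror {n : ℕ} (x α : Fin n → ℕ) (t : Triple n) (p : ℕ → ℕ) (τ : Equiv.Perm (Fin n))
    (s : BurnState n) (u : UnburnState n) : Prop where
  burnInv : BurnInv x α s u.head.val p
  unburnInv : UnburnInv x t p u s.counter
  perm : ∀ j, (τ j).val + 1 ≤ s.counter → s.perm ((τ j).val + 1) = j.succ
  todo : ∀ j, τ j ∈ u.todo ↔ j ∈ s.todo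
  chips : ∀ j, s.chips j + u.chips (τ j) = α j
  burnt : ∀ a ≤ s.counter, ∀ j : Fin n, s.counter ≤ (τ j).val →
    u.burnt.count s(vert n a, (τ j).succ) = s.burntCount a j
  label : ∀ k, 0 < k → k ≤ s.counter →
    s.label s(s.perm (p k), s.perm k) = t.labelAt s(vert n (p k), vert n k)

namespace Mirror

variable {n : ℕ} {x α : Fin n → ℕ} {t : Triple n} {p : ℕ → ℕ} {τ : Equiv.Perm (Fin n)}
  {s : BurnState n} {u v : UnburnState n} {j : Fin n}

lemma initial (ht : IsTriple x t p) : Mirror x α t p τ (burnInit x α) (unburnInit n) where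
  burnInv := BurnInv.initial x α ht.rooted.lt
  unburnInv := UnburnInv.initial ht
  perm := fun _ hj => absurd hj (Nat.not_succ_le_zero _)
  todo := fun j => by simp [burnInit, unburnInit, mem_notBurning]
  chips := fun _ => Nat.add_zero _
  burnt := fun _ _ _ _ => (Multiset.count_zero _).trans (Multiset.count_zero _).symm
  label := fun _ hk0 hk => absurd hk hk0.not_ge

lemma succ_notMem (M : Mirror x α t p τ s u) : j.succ ∉ s.burning ↔ s.counter ≤ (τ j).val := by
  rw [M.burnInv.mem_burning]
  constructor
  · intro hnot
    by_contra hlt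
    exact hnot ⟨(τ j).val + 1, by omega, M.perm j (by omega)⟩
  · rintro hle ⟨k, hk, hkj⟩
    obtain _ | k := k
    · exact Fin.succ_ne_zero _ (hkj.symm.trans M.burnInv.rooted.zero)
    · obtain ⟨i, hi⟩ := τ.surjective ⟨k, hk.trans M.burnInv.counter_le⟩
      obtain rfl : (τ i).val = k := congrArg Fin.val hi
      obtain rfl : i = j := Fin.succ_injective _ ((M.perm i hk).symm.trans hkj)
      exact hk.not_gt (Nat.lt_add_one_of_le hle)

lemma mem_notBurning_iff (M : Mirror x α t p τ s u) :
    τ j ∈ notBurning u.burning ↔ j ∈ notBurning s.burning := by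
  rw [M.unburnInv.mem_notBurning_iff, mem_notBurning, M.succ_notMem]

lemma todo_eq_empty (M : Mirror x α t p τ s u) (htodo : s.todo = ∅) : u.todo = ∅ := by
  refine Finset.eq_empty_of_forall_notMem fun k hk => ?_
  obtain ⟨j, rfl⟩ := τ.surjective k
  exact Finset.notMem_empty j (htodo ▸ (M.todo j).1 hk)

lemma maxOf_todo (M : Mirror x α t p τ s u) [IsStrictTotalOrder (Fin n) t.lt]
    (hτ : ∀ i j, t.lt (τ i) (τ j) ↔ i < j) (hm : maxOf (· < ·) s.todo = some j) :
    maxOf t.lt u.todo = some (τ j) := by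
  obtain ⟨hj, hmax⟩ := maxOf_eq_some.1 hm
  refine maxOf_eq_some.2 ⟨(M.todo j).2 hj, fun k hk hkj => ?_⟩
  obtain ⟨k, rfl⟩ := τ.surjective k
  exact (hτ k j).2 (hmax k ((M.todo k).1 hk) (ne_of_apply_ne τ hkj))

lemma count_head (M : Mirror x α t p τ s u) (hj : j.succ ∉ s.burning) :
    u.burnt.count s(u.head, (τ j).succ) = s.burntCount u.head.val j := by
  rw [← M.burnt _ M.unburnInv.head_le j (M.succ_notMem.1 hj), vert_val]

lemma mem_edges_sub_burnt_iff (M : Mirror x α t p τ s u) (hj : j.succ ∉ s.burning) :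
    s(u.head, (τ j).succ) ∈ (Gx x).edges - u.burnt ↔ s(s.head, j.succ) ∈ s.edges - s.burnt := by
  rw [M.unburnInv.mem_edges_sub_burnt_iff (M.succ_notMem.1 hj),
    M.burnInv.mem_edges_sub_burnt_iff M.burnInv.toBurnTree hj, M.count_head hj]

lemma skip (M : Mirror x α t p τ s u) (hj : j.succ ∉ s.burning)
    (hav : s(s.head, j.succ) ∉ s.edges - s.burnt) : Mirror x α t p τ (s.skip j) (u.skip (τ j)) where
  burnInv := M.burnInv.skip hj hav
  unburnInv := M.unburnInv.skip (mt (M.mem_edges_sub_burnt_iff hj).1 hav)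
  perm := M.perm
  todo := fun k => by
    rw [UnburnState.skip, BurnState.skip, Finset.mem_erase, Finset.mem_erase, M.todo,
      τ.injective.ne_iff]
  chips := M.chips
  burnt := M.burnt
  label := M.label

lemma backtrack (M : Mirror x α t p τ s u) (ht : IsTriple x t p) (htodo : s.todo = ∅)
    (hhead : u.head ≠ 0) : Mirror x α t p τ s.backtrack (u.backtrack t) where
  burnInv := by
    rw [M.unburnInv.backtrack_head_val ht hhead]
    exact M.burnInv.backtrack htodo (Fin.pos_of_ne_zero hhead)
  unburnInv := M.unburnInv.backtrack ht (M.todo_eq_empty htodo) hhead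
  perm := M.perm
  todo := fun _ => M.mem_notBurning_iff
  chips := M.chips
  burnt := M.burnt
  label := M.label

lemma burnEdge (M : Mirror x α t p τ s u) (ht : IsTriple x t p) (hj : j ∈ s.todo)
    (hmax : ∀ k ∈ s.todo, k ≤ j) (hav : s(s.head, j.succ) ∈ s.edges - s.burnt)
    (hchips : 1 ≤ s.chips j) (hign : ¬ u.Ignites (Gx x) t (τ j)) :
    Mirror x α t p τ (s.burnEdge j) (u.burnEdge (τ j)) where
  burnInv := M.burnInv.burnEdge hj hmax hav hchips
  unburnInv := M.unburnInv.burnEdge ht (M.succ_notMem.1 (M.burnInv.todo j hj))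
    ((M.mem_edges_sub_burnt_iff (M.burnInv.todo j hj)).2 hav) hign
  perm := M.perm
  todo := M.todo
  chips := fun k => by
    rw [BurnState.burnEdge_chips, UnburnState.burnEdge_chips, ← M.chips k]
    obtain rfl | hkj := eq_or_ne k j
    · rw [Function.update_self, Function.update_self]
      omega
    · rw [Function.update_of_ne hkj, Function.update_of_ne (τ.injective.ne hkj)]
  burnt := fun a ha k hk => by
    have hjB := M.burnInv.todo j hj
    have han : a ≤ n := le_trans ha M.burnInv.counter_le
    have haB : vert n a ∈ u.burning := (M.unburnInv.mem_burning _).2 (by rwa [val_vert han])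
    have hjC := M.unburnInv.succ_notMem.2 (M.succ_notMem.1 hjB)
    rw [M.burnInv.burnEdge_burntCount hjB ha, ← M.burnt a ha k hk, UnburnState.burnEdge,
      Multiset.count_add, Multiset.count_singleton]
    refine congrArg _ (if_congr ?_ rfl rfl)
    rw [mk_eq_mk_iff_of_mem haB hjC, Fin.succ_inj, τ.injective.eq_iff, Fin.ext_iff, val_vert han]
  label := M.label

lemma ignite_perm (M : Mirror x α t p τ s u) (hj : (τ j).val = s.counter) (k : Fin n)
    (hk : (τ k).val + 1 ≤ s.counter + 1) : (ignite x s j).perm ((τ k).val + 1) = k.succ := by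
  obtain hk | hk := Nat.le_add_one_iff.1 hk
  · rw [ignite_perm_of_le hk, M.perm k hk]
  · obtain rfl : k = j := τ.injective (Fin.ext (by omega))
    rw [hk, ignite_perm_self]

lemma ignite_burnt (M : Mirror x α t p τ s u) (hj : (τ j).val = s.counter) {a : ℕ}
    (ha : a ≤ s.counter + 1) {k : Fin n} (hk : s.counter + 1 ≤ (τ k).val) :
    (u.ignite (τ j)).burnt.count s(vert n a, (τ k).succ) = (ignite x s j).burntCount a k := by
  obtain ha | rfl := Nat.le_add_one_iff.1 ha
  · rw [ignite_burntCount_of_le ha]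
    exact M.burnt a ha k (by omega)
  · have hjB := M.succ_notMem.2 hj.ge
    have hkB : k.succ ∉ s.burning := M.succ_notMem.2 (by omega)
    rw [M.burnInv.ignite_burntCount_self hjB hkB, ← hj, vert_succ]
    exact M.unburnInv.burnt_zero _ _ (M.unburnInv.succ_notMem.2 hj.ge)
      (M.unburnInv.succ_notMem.2 (by omega))

lemma ignite_label (M : Mirror x α t p τ s u) (ht : IsTriple x t p) (hj : (τ j).val = s.counter)
    (hav : s(s.head, j.succ) ∈ s.edges - s.burnt) (hign : u.Ignites (Gx x) t (τ j)) {k : ℕ}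
    (hk0 : 0 < k) (hk : k ≤ s.counter + 1) :
    (ignite x s j).label s((ignite x s j).perm (p k), (ignite x s j).perm k) =
      t.labelAt s(vert n (p k), vert n k) := by
  have hjB := M.succ_notMem.2 hj.ge
  obtain hk | rfl := Nat.le_add_one_iff.1 hk
  · have hpk := M.burnInv.rooted.parent_le hk0 hk
    rw [ignite_perm_of_le hk, ignite_perm_of_le hpk,
      ignite_label_of_mem hjB (M.burnInv.perm_mem hpk) (M.burnInv.perm_mem hk)]
    exact M.label k hk0 hk
  · have hself := M.burnInv.ignite_label_self M.burnInv.toBurnTree hjB hav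
    obtain ⟨hp, hlabel⟩ := (M.unburnInv.ignites_iff ht hj.ge
      ((M.mem_edges_sub_burnt_iff hjB).2 hav)).1 hign
    rw [M.count_head hjB] at hlabel
    rw [ignite_perm_self, ← hj, hp, ignite_perm_of_le M.unburnInv.head_le, vert_val, vert_succ]
    omega

lemma ignite (M : Mirror x α t p τ s u) (ht : IsTriple x t p) (hj : j ∈ s.todo)
    (hmax : ∀ k ∈ s.todo, k ≤ j) (hcounter : (τ j).val = s.counter)
    (hav : s(s.head, j.succ) ∈ s.edges - s.burnt) (hchips : s.chips j = 0)
    (hign : u.Ignites (Gx x) t (τ j)) :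
    Mirror x α t p τ (ignite x s j) (u.ignite (τ j)) := by
  have hp := ((M.unburnInv.ignites_iff ht hcounter.ge
    ((M.mem_edges_sub_burnt_iff (M.burnInv.todo j hj)).2 hav)).1 hign).1
  exact
    { burnInv := by
        have hburn := M.burnInv.ignite hj hmax hav hchips (hcounter ▸ hp)
        rwa [← hcounter] at hburn
      unburnInv := M.unburnInv.ignite hcounter hp
      perm := M.ignite_perm hcounter
      todo := fun k => by
        rw [UnburnState.ignite, VectorParking.ignite, mem_notBurning, mem_notBurning,
          Finset.mem_insert, Finset.mem_insert, not_or, not_or, ← mem_notBurning, ← mem_notBurning,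
          M.mem_notBurning_iff, Fin.succ_inj, Fin.succ_inj, τ.injective.eq_iff]
      chips := M.chips
      burnt := fun a ha k hk => M.ignite_burnt hcounter ha hk
      label := fun k hk0 hk => M.ignite_label ht hcounter hav hign hk0 hk }

lemma chips_eq_zero (M : Mirror x α t p τ s u) (hα : α j = v.chips (τ j))
    (hext : (u.ignite (τ j)).Extends v) : s.chips j = 0 := by
  have hchips := M.chips j
  have hfinal : v.chips (τ j) = u.chips (τ j) :=
    hext.chips_eq (τ j) (Finset.mem_insert_self _ _)
  omega

lemma one_le_chips (M : Mirror x α t p τ s u) (hα : α j = v.chips (τ j))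
    (hext : (u.burnEdge (τ j)).Extends v) : 1 ≤ s.chips j := by
  have hchips := M.chips j
  have hfinal := hext.chips_le (τ j)
  rw [UnburnState.burnEdge_chips, Function.update_self] at hfinal
  omega

/-- The tests of the two algorithms agree because `α` is read off the final state `v`: on its way to
`v` the inverse algorithm puts another chip on `τ j` if and only if `τ j` does not ignite now. -/
lemma exists_step (M : Mirror x α t p τ s u) (ht : IsTriple x t p)
    (hτ : ∀ i j, t.lt (τ i) (τ j) ↔ i < j) (hv : unburnStep (Gx x) t v = none)
    (huv : StateTransition.Reaches (unburnStep (Gx x) t) u v) (hα : ∀ j, α j = v.chips (τ j)) :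
    (burnStep x s = none ∧ s.counter = n) ∨
    ∃ s' u', burnStep x s = some s' ∧ unburnStep (Gx x) t u = some u' ∧ Mirror x α t p τ s' u' := by
  have := ht.total
  obtain hm | ⟨j, hm⟩ := (maxOf (· < ·) s.todo).eq_none_or_eq_some
  · have htodo := maxOf_eq_none.1 hm
    have htodo' := M.todo_eq_empty htodo
    have hhead : s.head = 0 ↔ u.head = 0 := M.burnInv.head_eq_zero_iff.trans Fin.val_eq_zero_iff
    by_cases hroot : u.head = 0
    · exact Or.inl ⟨burnStep_of_head_eq_zero htodo (hhead.2 hroot),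
        M.unburnInv.eq_of_head_eq_zero ht htodo' hroot⟩
    · exact Or.inr ⟨_, _, burnStep_of_head_ne_zero htodo (mt hhead.1 hroot),
        unburnStep_of_head_ne_zero htodo' hroot, M.backtrack ht htodo hroot⟩
  right
  have hm' := M.maxOf_todo hτ hm
  obtain ⟨hj', hmax'⟩ := maxOf_eq_some.1 hm'
  have hj := (maxOf_eq_some.1 hm).1
  have hjB := M.burnInv.todo j hj
  have hmax : ∀ k ∈ s.todo, k ≤ j := fun _ => le_of_maxOf_eq_some hm
  by_cases hav : s(s.head, j.succ) ∈ s.edges - s.burnt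
  · have hav' := (M.mem_edges_sub_burnt_iff hjB).2 hav
    by_cases hign : u.Ignites (Gx x) t (τ j)
    · have hstep := unburnStep_of_ignites hm' hav' hign
      have hp := ((M.unburnInv.ignites_iff ht (M.succ_notMem.1 hjB) hav').1 hign).1
      have hcounter := M.unburnInv.val_eq_of_parent_eq_head ht hj' hmax' hp
      have hchips := M.chips_eq_zero (hα j) <|
        (M.unburnInv.ignite hcounter hp).extends_of_reaches ht (reaches_of_step huv hv hstep)
      exact ⟨_, _, burnStep_of_eq_zero hm hav hchips, hstep,
        M.ignite ht hj hmax hcounter hav hchips hign⟩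
    · have hstep := unburnStep_of_not_ignites hm' hav' hign
      have hchips := M.one_le_chips (hα j) <|
        (M.unburnInv.burnEdge ht (M.succ_notMem.1 hjB) hav' hign).extends_of_reaches ht
          (reaches_of_step huv hv hstep)
      exact ⟨_, _, burnStep_of_pos hm hav hchips, hstep, M.burnEdge ht hj hmax hav hchips hign⟩
  · exact ⟨_, _, burnStep_of_notMem hm hav,
      unburnStep_of_notMem hm' (mt (M.mem_edges_sub_burnt_iff hjB).1 hav), M.skip hjB hav⟩

lemma exists_of_reaches (M : Mirror x α t p τ s u) (ht : IsTriple x t p)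
    (hτ : ∀ i j, t.lt (τ i) (τ j) ↔ i < j) (hv : unburnStep (Gx x) t v = none)
    (huv : StateTransition.Reaches (unburnStep (Gx x) t) u v) (hα : ∀ j, α j = v.chips (τ j))
    {f : BurnState n} (hf : burnStep x f = none) (hsf : StateTransition.Reaches (burnStep x) s f) :
    ∃ w, Mirror x α t p τ f w ∧ f.counter = n := by
  induction hsf using Relation.ReflTransGen.head_induction_on generalizing u with
  | refl =>
    obtain ⟨-, hcounter⟩ | ⟨s', _, hsome, -⟩ := M.exists_step ht hτ hv huv hα
    · exact ⟨u, M, hcounter⟩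
    · exact absurd (hf.symm.trans hsome) (Option.some_ne_none s').symm
  | @head s r hsr _ ih =>
    obtain ⟨hnone, -⟩ | ⟨s', u', hsome, hu, M'⟩ := M.exists_step ht hτ hv huv hα
    · exact absurd (hnone.symm.trans hsr) (Option.some_ne_none r).symm
    · obtain rfl := Option.some.inj (hsome.symm.trans hsr)
      exact ih M' (reaches_of_step huv hv hu)

lemma output_eq (M : Mirror x α t p τ s u) (ht : IsTriple x t p)
    (hτ : ∀ i j, t.lt (τ i) (τ j) ↔ i < j) (hc : s.counter = n) : burnOutput s = t := by
  have hroot := M.burnInv.rooted_output hc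
  refine Triple.ext_labelAt ?_ (fun e he => ?_) fun i j => ?_
  · ext a b
    rw [hroot.adj, ht.rooted.adj]
  · obtain ⟨j, hj⟩ := hroot.parentEdge_bijective.2 ⟨e, he⟩
    obtain rfl : parentEdge n p j = e := congrArg Subtype.val hj
    rw [parentEdge, ← vert_succ, M.burnInv.labelAt_output hc (Nat.succ_pos _) j.isLt]
    exact M.label _ (Nat.succ_pos _) (j.isLt.trans_eq hc.symm)
  · have hperm : ∀ i : Fin n, s.perm (i.val + 1) = (τ.symm i).succ := fun i => by
      have hi := M.perm (τ.symm i) ((τ (τ.symm i)).isLt.trans_eq hc.symm)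
      rwa [Equiv.apply_symm_apply] at hi
    rw [BurnInv.output_lt_iff_of_perm hc hperm, ← hτ, Equiv.apply_symm_apply,
      Equiv.apply_symm_apply]

end Mirror

/-! ### The bijection -/

lemma exists_vectorDFS_eq {n : ℕ} {x α : Fin n → ℕ} (hα : IsParking x α) :
    ∃ t ∈ Triples x, vectorDFS x α = Part.some t ∧ Encodes x α t := by
  obtain ⟨s, p, hreach, hhalt, H, htodo⟩ := burn_terminates x α
  have hc := H.counter_eq_of_isParking htodo hα
  refine ⟨burnOutput s, H.output_mem_triples hc, ?_, H.encodes_output hc⟩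
  rw [vectorDFS, eval_eq_some hreach hhalt, Part.map_some]

lemma exists_vectorInverse_eq {n : ℕ} {x : Fin n → ℕ} {t : Triple n} (ht : t ∈ Triples x) :
    ∃ α ∈ PF x, vectorInverse x t = Part.some α ∧ vectorDFS x α = Part.some t ∧
      Encodes x α t := by
  obtain ⟨p, ht⟩ := exists_isTriple ht
  have := ht.total
  have hτ : ∀ i j, t.lt (sortPerm t.lt i) (sortPerm t.lt j) ↔ i < j := fun _ _ => sortPerm_lt_iff
  obtain ⟨v, huv, hv⟩ := unburn_terminates ht
  let α := v.chips ∘ sortPerm t.lt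
  obtain ⟨s, _, hreach, hhalt, -⟩ := burn_terminates x α
  obtain ⟨w, M, hc⟩ :=
    (Mirror.initial ht).exists_of_reaches ht hτ hv huv (fun _ => rfl) hhalt hreach
  have hout := M.output_eq ht hτ hc
  have henc : Encodes x α t := hout ▸ M.burnInv.encodes_output hc
  refine ⟨α, henc.isParking, ?_, ?_, henc⟩
  · rw [vectorInverse, multigraphInverse, eval_eq_some huv hv, Part.map_some, Part.map_some]
  · rw [vectorDFS, eval_eq_some hreach hhalt, Part.map_some, hout]

end VectorParking

theorem mainTheorem2 {n : ℕ} (x : Fin n → ℕ) :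
    ∃ ψ : VectorParking.PF x ≃ VectorParking.Triples x,
      (∀ α : VectorParking.PF x,
        VectorParking.vectorDFS x α.val = Part.some (ψ α).val) ∧
      (∀ α : VectorParking.PF x,
        VectorParking.rsum x α.val =
          (VectorParking.kappa (VectorParking.Gx x) (ψ α).val.tree (ψ α).val.lt : ℤ) +
            ((ψ α).val.labelSum : ℤ)) ∧
      (∀ t : VectorParking.Triples x,
        VectorParking.vectorInverse x t.val = Part.some (ψ.symm t).val) := by
  choose f hf hfeval hfenc using fun α : VectorParking.PF x => VectorParking.exists_vectorDFS_eq α.2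
  choose g hg hgeval hgdfs hgenc using
    fun t : VectorParking.Triples x => VectorParking.exists_vectorInverse_eq t.2
  refine ⟨⟨fun α => ⟨f α, hf α⟩, fun t => ⟨g t, hg t⟩, fun α => Subtype.ext ?_,
    fun t => Subtype.ext ?_⟩, hfeval, fun α => ?_, hgeval⟩
  · exact (hgenc ⟨f α, hf α⟩).unique (hfenc α)
  · exact Part.some_inj.1 ((hfeval ⟨g t, hg t⟩).symm.trans (hgdfs t))
  · obtain ⟨p, hp⟩ := VectorParking.exists_isTriple (hf α)
    exact (hfenc α).rsum_eq hp.rooted
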